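/- Let $d,N\ge 1$, $s\in\mathbb R$ and $p,q\in(0,\infty]$, with the convention $d/p=0$ if $p=\infty$. Let $\psi^{(1)},\dots,\psi^{(N)}$ be bounded functions with fast decay on $\mathbb R^d$ (for every $n$, $|\psi^{(i)}(x)|\le B_n(1+|x|)^{-n}$), and let $\psi^{(i)}_{j,k}(x)=\psi^{(i)}(2^jx-k)$ for $j\ge 0$, $k\in\mathbb Z^d$. Assume the dyadic covering property: there are $C_0>0$ and finitely many triplets $(i_l,j_l,k_l)$, $l=1,\dots,L$, with $j_l>0$, such that for every $x\in[0,1)^d$ some $l$ satisfies $|\psi^{(i_l)}(2^{j_l}x-k_l)|\ge C_0$. Let $M=\max_l j_l$. **Function spaces and divergence.** A sequence $c=(c^{(i)}_{j,k})$ belongs to $b^{s,q}_p$ if $\varepsilon_j=\big(\sum_{i,k}|c^{(i)}_{j,k}2^{(s-d/p)j}|^p\big)^{1/p}$ defines a sequence in $\ell^q$ (suprema if $p$ or $q$ is $\infty$); $b^{s,q}_p$ carries the topology of the corresponding (quasi-)norm. The divergence exponent $\delta_c(x)\in[-\infty,\infty]$ is the supremum of the $\gamma\in\mathbb R$ for which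 there are $C>0$ and indices $(i_n,j_n,k_n)$ with $j_n\to\infty$ and $|c^{(i_n)}_{j_n,k_n}\psi^{(i_n)}_{j_n,k_n}(x)|\ge C2^{\gamma j_n}$ for all $n$. The wavelet series of $c\in b^{s,q}_p$ is maximally divergent on $A\subseteq\mathbb R^d$ if * $\delta_c(x)\in[-s,\frac dp-s]$ for every $x\in A$; * $\delta_c(x)=-s$ for almost every $x\in A$; * for every non-empty open set $B\subseteq A$ and every $\gamma\in[-s,\frac dp-s]$, the set $\{x\in B:\delta_c(x)=\gamma\}$ has Hausdorff dimension $d-sp-\gamma p$ (read as $d$ if $p=\infty$). **The saturating sequence.** For $j\ge1$ and $k\in\{0,\dots,2^j-1\}^d$, let $\nu=2^{-j}(k+[0,1)^d)$, let $J\le j$ be the least non-negative integer with $2^{J}\,k/2^{j}\in\mathbb Z^d$, and set $$e_\nu=2^{-(\log j)^2}\,2^{(\frac dp-s)j}\,2^{-\frac dpJ}.$$ For a dyadic cube $\nu=2^{-j}(k+[0,1)^d)$ let $\mu^l(\nu)$ be the dyadic cube of scale $j+j_l$ and position $2^{j_l}k+k_l$, i.e. the image of the dyadic cube $2^{-j_l}(k_l+[0,1)^d)$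 under the affine map $x\mapsto 2^{-j}(k+x)$ from $[0,1)^d$ onto $\nu$. For a dyadic cube $\lambda$ of scale $j\in\{mM+1,\dots,(m+1)M\}$, $m\ge1$, let $f_\lambda$ be the largest of the numbers $e_\nu$ over the dyadic cubes $\nu\subseteq[0,1)^d$ of scale $mM$ with $\mu^l(\nu)=\lambda$ for some $l$, and $f_\lambda=0$ if there is no such $\nu$; let $f_\lambda=0$ for the cubes of scale at most $M$. Let $\xi^{(i)}_\lambda$ be independent random variables, uniformly distributed on $[-1,1]$, and let $\mathcal C$ be the random sequence with coefficients $c^{(i)}_\lambda=\xi^{(i)}_\lambda f_\lambda$. **Theorem.** There is a (deterministic) compact subset of $b^{s,q}_p$ which contains $\mathcal C$ almost surely, and indeed whenever all the $\xi^{(i)}_\lambda$ take their values in $[-1,1]$. Almost surely, the wavelet series of $\mathcal C$ is maximally divergent on $[0,1)^d$. -/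

import Mathlib

open MeasureTheory ProbabilityTheory Filter Topology Set
open scoped ENNReal

noncomputable section

namespace SaturatingWavelets

/-- Euclidean space `ℝ^d`. -/
abbrev E (d : ℕ) : Type := EuclideanSpace ℝ (Fin d)

/-- The indices `(i, j, k)`: the generating function `i` (one of `N`), the scale `j ≥ 0` and the
translation `k ∈ ℤ^d`. The pair `(j, k)` stands for the dyadic cube `2^{-j} (k + [0,1)^d)`. -/
abbrev Idx (N d : ℕ) : Type := Fin N × ℕ × (Fin d → ℤ)

/-- The half-open unit cube `[0,1)^d`. -/
def unitCube (d : ℕ) : Set (E d) := {x | ∀ t, 0 ≤ x t ∧ x t < 1}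

/-! ### Wavelet systems and divergence exponents -/

section Wavelets

variable {𝕜 : Type*} [RCLike 𝕜] {N d : ℕ}

/-- Bounded functions with fast decay (the case `n = 0` is boundedness). -/
def IsWaveletGenerator (ψ : Fin N → E d → 𝕜) : Prop :=
  ∀ i, ∀ n : ℕ, ∃ B : ℝ, ∀ x, ‖ψ i x‖ ≤ B / (1 + ‖x‖) ^ n

/-- `ψ^{(i)}_{j,k}(x) = ψ^{(i)}(2^j x - k)`. -/
def wavelet (ψ : Fin N → E d → 𝕜) (a : Idx N d) (x : E d) : 𝕜 :=
  ψ a.1 (WithLp.toLp 2 fun t => (2 : ℝ) ^ a.2.1 * x t - (a.2.2 t : ℝ))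

/-- The wavelet series with coefficients `c` diverges at rate at least `γ` at `x`. -/
def DivergesAtRate (ψ : Fin N → E d → 𝕜) (c : Idx N d → ℝ) (γ : ℝ) (x : E d) : Prop :=
  ∃ C : ℝ, 0 < C ∧ ∃ a : ℕ → Idx N d, Tendsto (fun n => (a n).2.1) atTop atTop ∧
    ∀ n, C * (2 : ℝ) ^ (γ * ((a n).2.1 : ℝ)) ≤ ‖c (a n) • wavelet ψ (a n) x‖

/-- The divergence exponent `δ_c(x) ∈ [-∞, ∞]` of the wavelet series with coefficients `c`. -/
def divExponent (ψ : Fin N → E d → 𝕜) (c : Idx N d → ℝ) (x : E d) : EReal :=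
  ⨆ (γ : ℝ) (_ : DivergesAtRate ψ c γ x), (γ : EReal)

end Wavelets

/-! ### Discrete Besov spaces -/

/-- The (quasi-)norm of `ℓ^p`, `p ∈ (0, ∞]`, for families of elements of `[0, ∞]`. -/
def ellNorm {ι : Type*} (p : ℝ≥0∞) (f : ι → ℝ≥0∞) : ℝ≥0∞ :=
  if p = ⊤ then ⨆ a, f a else (∑' a, f a ^ p.toReal) ^ (1 / p.toReal)

/-- The number `d / p`, which is `0` for `p = ∞`. -/
def dOver (d : ℕ) (p : ℝ≥0∞) : ℝ := ((d : ℝ≥0∞) / p).toReal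

/-- The (quasi-)norm of the discrete Besov space `b^{s,q}_p`: the `ℓ^q` norm in `j` of the `ℓ^p`
norms in `(i, k)` of `c^{(i)}_{j,k} 2^{(s - d/p) j}`. -/
def besovNorm {N d : ℕ} (s : ℝ) (p q : ℝ≥0∞) (c : Idx N d → ℝ) : ℝ≥0∞ :=
  ellNorm q fun j : ℕ => ellNorm p fun ik : Fin N × (Fin d → ℤ) =>
    ENNReal.ofReal |c (ik.1, j, ik.2) * (2 : ℝ) ^ ((s - dOver d p) * (j : ℝ))|

/-- The discrete Besov space `b^{s,q}_p`. -/
def Besov (N d : ℕ) (s : ℝ) (p q : ℝ≥0∞) : Type :=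
  {c : Idx N d → ℝ // besovNorm s p q c < ⊤}

/-- The topology of `b^{s,q}_p` given by its (quasi-)norm: a set is open when it contains a ball
around each of its points. -/
instance (N d : ℕ) (s : ℝ) (p q : ℝ≥0∞) : TopologicalSpace (Besov N d s p q) where
  IsOpen U := ∀ c ∈ U, ∃ r : ℝ≥0∞, 0 < r ∧
    ∀ c' : Besov N d s p q, besovNorm s p q (c'.1 - c.1) < r → c' ∈ U
  isOpen_univ := fun _ _ => ⟨1, one_pos, fun _ _ => Set.mem_univ _⟩
  isOpen_inter := by
    intro U V hU hV c hc
    obtain ⟨r, hr, h⟩ := hU c hc.1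
    obtain ⟨r', hr', h'⟩ := hV c hc.2
    exact ⟨min r r', lt_min hr hr', fun c' hc' =>
      ⟨h c' (hc'.trans_le (min_le_left _ _)), h' c' (hc'.trans_le (min_le_right _ _))⟩⟩
  isOpen_sUnion := by
    intro S hS c hc
    obtain ⟨U, hUS, hcU⟩ := hc
    obtain ⟨r, hr, h⟩ := hS U hUS c hcU
    exact ⟨r, hr, fun c' hc' => ⟨U, hUS, h c' hc'⟩⟩

/-! ### Maximal divergence -/

/-- The wavelet series with coefficients `c` is maximally divergent in `A`. In the last clause the
dimension is `d - (s + γ) p`, which lies in `[0, d]` for the values of `γ` considered; for `p = ∞`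
only `γ = -s` occurs, and the value is `d`, by `0 * ∞ = 0`. -/
def MaximallyDivergent {𝕜 : Type*} [RCLike 𝕜] {N d : ℕ} (ψ : Fin N → E d → 𝕜)
    (s : ℝ) (p : ℝ≥0∞) (c : Idx N d → ℝ) (A : Set (E d)) : Prop :=
  (∀ x ∈ A, ((-s : ℝ) : EReal) ≤ divExponent ψ c x ∧
    divExponent ψ c x ≤ ((dOver d p - s : ℝ) : EReal)) ∧
  (∀ᵐ x ∂(volume : Measure (E d)), x ∈ A → divExponent ψ c x = ((-s : ℝ) : EReal)) ∧
  (∀ B : Set (E d), IsOpen B → B.Nonempty → B ⊆ A →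
    ∀ γ ∈ Set.Icc (-s) (dOver d p - s),
      dimH {x | x ∈ B ∧ divExponent ψ c x = (γ : EReal)} =
        (d : ℝ≥0∞) - ENNReal.ofReal (s + γ) * p)

/-! ### Dyadic coverings and the saturating sequence -/

/-- The dyadic covering property, with the finite collection of triplets
`T l = (i_l, j_l, k_l)`. -/
def IsDyadicCovering {𝕜 : Type*} [RCLike 𝕜] {N d L : ℕ} (ψ : Fin N → E d → 𝕜)
    (T : Fin L → Idx N d) : Prop :=
  (∀ l, 0 < (T l).2.1) ∧
  ∃ C₀ : ℝ, 0 < C₀ ∧ ∀ x ∈ unitCube d, ∃ l, C₀ ≤ ‖wavelet ψ (T l) x‖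

/-- The depth `M`: the largest of the scales `j_l`. -/
def depth {N d L : ℕ} (T : Fin L → Idx N d) : ℕ := Finset.univ.sup fun l => (T l).2.1

/-- The scale `J` of the irreducible form `k / 2^j = k' / 2^J`, that is, the least `J ≤ j` such that
`2^J (k / 2^j)` is an integer vector (so `J = 0` if `k = 0`). -/
def irredScale {d : ℕ} (j : ℕ) (k : Fin d → ℤ) : ℕ :=
  sInf {J : ℕ | J ≤ j ∧ ∀ t, (2 : ℤ) ^ (j - J) ∣ k t}

/-- `e_λ = 2^{-(log j)^2} 2^{(d/p - s) j} 2^{-(d/p) J}` for the dyadic cube `λ` given by `(j, k)`. -/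
def eCoeff {d : ℕ} (s : ℝ) (p : ℝ≥0∞) (j : ℕ) (k : Fin d → ℤ) : ℝ :=
  (2 : ℝ) ^ (-(Real.log j) ^ 2) * (2 : ℝ) ^ ((dOver d p - s) * (j : ℝ)) *
    (2 : ℝ) ^ (-(dOver d p) * (irredScale j k : ℝ))

/-- `f_λ` for the dyadic cube `λ` given by `(j, k)`: the largest `e_ν` over the cubes
`ν = 2^{-mM} (κ + [0,1)^d) ⊆ [0,1)^d`, `m ≥ 1`, such that for some `l` the affine map
`x ↦ 2^{-mM} (κ + x)` from the unit cube onto `ν` sends the dyadic cube of `(j_l, k_l)` onto `λ`;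
it is `0` if there are none. As `1 ≤ j_l ≤ M`, the number `m` is the one with
`mM < j ≤ (m + 1) M`. The set below is finite, and the real supremum of `∅` is `0`. -/
def fCoeff {N d L : ℕ} (T : Fin L → Idx N d) (s : ℝ) (p : ℝ≥0∞) (j : ℕ) (k : Fin d → ℤ) : ℝ :=
  sSup {y : ℝ | ∃ (m : ℕ) (κ : Fin d → ℤ) (l : Fin L), 1 ≤ m ∧
    (∀ t, 0 ≤ κ t ∧ κ t < 2 ^ (m * depth T)) ∧
    j = m * depth T + (T l).2.1 ∧
    (∀ t, k t = 2 ^ (T l).2.1 * κ t + (T l).2.2 t) ∧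
    y = eCoeff s p (m * depth T) κ}

/-- The saturating sequence `c^{(i)}_λ = ξ^{(i)}_λ f_λ`. -/
def satSeq {N d L : ℕ} (T : Fin L → Idx N d) (s : ℝ) (p : ℝ≥0∞) {Ω : Type*}
    (ξ : Idx N d → Ω → ℝ) (ω : Ω) : Idx N d → ℝ :=
  fun a => ξ a ω * fCoeff T s p a.2.1 a.2.2

end SaturatingWavelets

end

noncomputable section

namespace SaturatingWavelets

/-! ### Elementary estimates -/

/-- `2^{-(log x)^2}` decays faster than every power of `x`. -/
lemma two_rpow_neg_sq_log_le (ρ : ℝ) :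
    ∃ C : ℝ, 0 < C ∧ ∀ x : ℝ, 0 < x → (2 : ℝ) ^ (-(Real.log x) ^ 2) ≤ C * x ^ (-ρ) := by
  have h2 : 0 < Real.log 2 := Real.log_pos (by norm_num)
  refine ⟨Real.exp (ρ ^ 2 / (4 * Real.log 2)), Real.exp_pos _, fun x hx => ?_⟩
  rw [Real.rpow_def_of_pos (by norm_num), Real.rpow_def_of_pos hx, ← Real.exp_add,
    Real.exp_le_exp]
  have : ρ ^ 2 / (4 * Real.log 2) + Real.log x * -ρ - Real.log 2 * -(Real.log x) ^ 2
      = (2 * Real.log 2 * Real.log x - ρ) ^ 2 / (4 * Real.log 2) := by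
    field_simp
    ring
  have h3 : 0 ≤ (2 * Real.log 2 * Real.log x - ρ) ^ 2 / (4 * Real.log 2) := by positivity
  linarith

/-- `(log n)^2` grows slower than every linear function. -/
lemma sq_log_le {ε : ℝ} (hε : 0 < ε) : ∃ C : ℝ, ∀ n : ℕ, (Real.log n) ^ 2 ≤ ε * n + C := by
  have h := (Real.isLittleO_pow_log_id_atTop (n := 2)).comp_tendsto
    (tendsto_natCast_atTop_atTop (R := ℝ))
  obtain ⟨n₀, hn₀⟩ := eventually_atTop.1 (h.bound hε)
  refine ⟨∑ n ∈ Finset.range n₀, (Real.log n) ^ 2, fun n => ?_⟩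
  have hs : 0 ≤ ∑ n ∈ Finset.range n₀, (Real.log n) ^ 2 := Finset.sum_nonneg fun _ _ => sq_nonneg _
  rcases le_or_gt n₀ n with hn | hn
  · have := hn₀ n hn
    simp only [Function.comp, id, Real.norm_eq_abs, Nat.abs_cast] at this
    exact ((le_abs_self _).trans this).trans (by linarith)
  · have := Finset.single_le_sum (f := fun n : ℕ => (Real.log n) ^ 2)
      (fun _ _ => sq_nonneg _) (Finset.mem_range.2 hn)
    have h0 : 0 ≤ ε * n := by positivity
    linarith

/-! ### The saturating sequence -/

lemma dOver_nonneg (d : ℕ) (p : ℝ≥0∞) : 0 ≤ dOver d p := ENNReal.toReal_nonneg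

lemma dOver_top (d : ℕ) : dOver d ⊤ = 0 := by simp [dOver]

lemma dOver_eq {d : ℕ} {p : ℝ≥0∞} : dOver d p = d / p.toReal := by
  simp [dOver, ENNReal.toReal_div]

lemma irredScale_mem {d : ℕ} (j : ℕ) (k : Fin d → ℤ) :
    irredScale j k ≤ j ∧ ∀ t, (2 : ℤ) ^ (j - irredScale j k) ∣ k t :=
  Nat.sInf_mem (s := {J : ℕ | J ≤ j ∧ ∀ t, (2 : ℤ) ^ (j - J) ∣ k t}) ⟨j, le_rfl, by simp⟩

lemma irredScale_le {d j J : ℕ} {k : Fin d → ℤ} (hJ : J ≤ j) (h : ∀ t, (2 : ℤ) ^ (j - J) ∣ k t) :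
    irredScale j k ≤ J :=
  Nat.sInf_le ⟨hJ, h⟩

lemma eCoeff_pos {d : ℕ} (s : ℝ) (p : ℝ≥0∞) (j : ℕ) (k : Fin d → ℤ) : 0 < eCoeff s p j k := by
  unfold eCoeff; positivity

lemma eCoeff_eq {d : ℕ} (s : ℝ) (p : ℝ≥0∞) (j : ℕ) (k : Fin d → ℤ) :
    eCoeff s p j k = (2 : ℝ) ^ (-(Real.log j) ^ 2 + (dOver d p - s) * j +
      -(dOver d p) * (irredScale j k : ℝ)) := by
  rw [eCoeff, Real.rpow_add two_pos, Real.rpow_add two_pos]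

lemma eCoeff_le {d : ℕ} (s : ℝ) (p : ℝ≥0∞) (j : ℕ) (k : Fin d → ℤ) :
    eCoeff s p j k ≤ (2 : ℝ) ^ ((dOver d p - s) * j - dOver d p * (irredScale j k : ℝ)) := by
  rw [eCoeff_eq]
  refine Real.rpow_le_rpow_of_exponent_le one_le_two ?_
  nlinarith [sq_nonneg (Real.log j)]

/-- The positions of the dyadic cubes of scale `j` contained in the unit cube. -/
def boxPos (d j : ℕ) : Finset (Fin d → ℤ) := Fintype.piFinset fun _ => Finset.Ico 0 (2 ^ j)

lemma mem_boxPos {d j : ℕ} {k : Fin d → ℤ} : k ∈ boxPos d j ↔ ∀ t, 0 ≤ k t ∧ k t < 2 ^ j := by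
  simp [boxPos]

lemma card_boxPos (d j : ℕ) : (boxPos d j).card = 2 ^ (d * j) := by
  have h : ((2 : ℤ) ^ j).toNat = 2 ^ j := by
    rw [show (2 : ℤ) ^ j = ((2 ^ j : ℕ) : ℤ) by push_cast; rfl, Int.toNat_natCast]
  simp [boxPos, Fintype.card_piFinset, h, ← pow_mul, mul_comm]

/-- A position with irreducible scale `J ≤ R` is a position of scale `R`, up to rescaling. -/
lemma exists_boxPos_of_irredScale_le {d j R : ℕ} {k : Fin d → ℤ} (hk : k ∈ boxPos d j)
    (hR : irredScale j k ≤ R) :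
    ∃ k' ∈ boxPos d R, ∀ t, (k t : ℝ) / 2 ^ j = (k' t : ℝ) / 2 ^ R := by
  obtain ⟨hJ, hdvd⟩ := irredScale_mem j k
  set J := irredScale j k
  choose q hq using hdvd
  have hk' := mem_boxPos.1 hk
  have hj : (2 : ℤ) ^ j = 2 ^ (j - J) * 2 ^ J := by rw [← pow_add, Nat.sub_add_cancel hJ]
  have hRp : (2 : ℤ) ^ R = 2 ^ (R - J) * 2 ^ J := by rw [← pow_add, Nat.sub_add_cancel hR]
  have h1 : (0 : ℤ) < 2 ^ (j - J) := by positivity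
  have h2 : (0 : ℤ) < 2 ^ (R - J) := by positivity
  refine ⟨fun t => 2 ^ (R - J) * q t, mem_boxPos.2 fun t => ⟨?_, ?_⟩, fun t => ?_⟩
  · have := (hk' t).1
    rw [hq t] at this
    exact mul_nonneg h2.le (nonneg_of_mul_nonneg_right this h1)
  · have := (hk' t).2
    rw [hq t, hj] at this
    rw [hRp]
    exact mul_lt_mul_of_pos_left (lt_of_mul_lt_mul_left this h1.le) h2
  · have hj' : (2 : ℝ) ^ j = 2 ^ (j - J) * 2 ^ J := by exact_mod_cast hj
    have hR' : (2 : ℝ) ^ R = 2 ^ (R - J) * 2 ^ J := by exact_mod_cast hRp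
    rw [hq t, hj', hR']
    push_cast
    field_simp

lemma card_filter_dvd_le {d j J : ℕ} (hJ : J ≤ j) :
    ((boxPos d j).filter fun k => ∀ t, (2 : ℤ) ^ (j - J) ∣ k t).card ≤ 2 ^ (d * J) := by
  rw [← card_boxPos d J]
  have h1 : (0 : ℤ) < 2 ^ (j - J) := by positivity
  have hj : (2 : ℤ) ^ j = 2 ^ (j - J) * 2 ^ J := by rw [← pow_add, Nat.sub_add_cancel hJ]
  refine (Finset.card_le_card (t := (boxPos d J).image fun q t => 2 ^ (j - J) * q t)
    fun k hk => ?_).trans Finset.card_image_le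
  obtain ⟨hk, hdvd⟩ := Finset.mem_filter.1 hk
  choose q hq using hdvd
  refine Finset.mem_image.2 ⟨q, mem_boxPos.2 fun t => ?_, funext fun t => (hq t).symm⟩
  have := mem_boxPos.1 hk t
  rw [hq t, hj] at this
  exact ⟨nonneg_of_mul_nonneg_right this.1 h1, lt_of_mul_lt_mul_left this.2 h1.le⟩

lemma sum_boxPos_irredScale_le (d j : ℕ) :
    ∑ k ∈ boxPos d j, (2 : ℝ) ^ (-(d : ℝ) * (irredScale j k : ℝ)) ≤ j + 1 := by
  calc ∑ k ∈ boxPos d j, (2 : ℝ) ^ (-(d : ℝ) * (irredScale j k : ℝ))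
      ≤ ∑ k ∈ boxPos d j, ∑ J ∈ Finset.range (j + 1),
          if ∀ t, (2 : ℤ) ^ (j - J) ∣ k t then (2 : ℝ) ^ (-(d : ℝ) * (J : ℝ)) else 0 := by
        refine Finset.sum_le_sum fun k _ => ?_
        obtain ⟨hJ, hdvd⟩ := irredScale_mem j k
        refine le_trans (le_of_eq (if_pos hdvd).symm) (Finset.single_le_sum
          (f := fun J => if ∀ t, (2 : ℤ) ^ (j - J) ∣ k t then (2 : ℝ) ^ (-(d : ℝ) * (J : ℝ)) else 0)
          (fun J _ => ?_) (Finset.mem_range.2 (Nat.lt_succ_of_le hJ)))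
        split_ifs <;> positivity
    _ = ∑ J ∈ Finset.range (j + 1), ∑ k ∈ boxPos d j,
          if ∀ t, (2 : ℤ) ^ (j - J) ∣ k t then (2 : ℝ) ^ (-(d : ℝ) * (J : ℝ)) else 0 :=
        Finset.sum_comm
    _ ≤ ∑ J ∈ Finset.range (j + 1), (1 : ℝ) := by
        refine Finset.sum_le_sum fun J hJ => ?_
        rw [← Finset.sum_filter, Finset.sum_const, nsmul_eq_mul]
        have h := card_filter_dvd_le (d := d) (Nat.lt_succ_iff.1 (Finset.mem_range.1 hJ))
        have h' : (((boxPos d j).filter fun k => ∀ t, (2 : ℤ) ^ (j - J) ∣ k t).card : ℝ)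
            ≤ 2 ^ ((d : ℝ) * J) := by
          have : (2 : ℝ) ^ ((d : ℝ) * J) = ((2 ^ (d * J) : ℕ) : ℝ) := by
            rw [← Nat.cast_mul, Real.rpow_natCast]; push_cast; rfl
          rw [this]
          exact_mod_cast h
        refine (mul_le_mul_of_nonneg_right h' (by positivity)).trans (le_of_eq ?_)
        rw [← Real.rpow_add two_pos]
        simp
    _ = j + 1 := by simp

section Covering

variable {𝕜 : Type*} [RCLike 𝕜] {N d L : ℕ} {T : Fin L → Idx N d}

lemma IsDyadicCovering.depth_pos {ψ : Fin N → E d → 𝕜} (hT : IsDyadicCovering ψ T) :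
    0 < depth T := by
  obtain ⟨h, C, hC, hx⟩ := hT
  obtain ⟨l, -⟩ := hx 0 (fun t => by simp)
  exact (h l).trans_le (Finset.le_sup (f := fun l => (T l).2.1) (Finset.mem_univ l))

lemma le_depth (T : Fin L → Idx N d) (l : Fin L) : (T l).2.1 ≤ depth T :=
  Finset.le_sup (f := fun l => (T l).2.1) (Finset.mem_univ l)

/-- The set whose supremum is `fCoeff`. -/
def fSet (T : Fin L → Idx N d) (s : ℝ) (p : ℝ≥0∞) (j : ℕ) (k : Fin d → ℤ) : Set ℝ :=
  {y : ℝ | ∃ (m : ℕ) (κ : Fin d → ℤ) (l : Fin L), 1 ≤ m ∧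
    (∀ t, 0 ≤ κ t ∧ κ t < 2 ^ (m * depth T)) ∧
    j = m * depth T + (T l).2.1 ∧
    (∀ t, k t = 2 ^ (T l).2.1 * κ t + (T l).2.2 t) ∧
    y = eCoeff s p (m * depth T) κ}

lemma finite_fSet (hM : 0 < depth T) (s : ℝ) (p : ℝ≥0∞) (j : ℕ) (k : Fin d → ℤ) :
    (fSet T s p j k).Finite := by
  refine ((Finset.range (j + 1)).biUnion fun m =>
    (boxPos d (m * depth T)).image fun κ => eCoeff s p (m * depth T) κ).finite_toSet.subset ?_
  rintro y ⟨m, κ, l, -, hκ, hj, -, rfl⟩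
  simp only [Finset.coe_biUnion, Finset.coe_image, mem_iUnion]
  refine ⟨m, ?_, κ, mem_boxPos.2 hκ, rfl⟩
  simp only [Finset.coe_range, mem_Iio]
  nlinarith

lemma fCoeff_nonneg (T : Fin L → Idx N d) (s : ℝ) (p : ℝ≥0∞) (j : ℕ) (k : Fin d → ℤ) :
    0 ≤ fCoeff T s p j k := by
  refine Real.sSup_nonneg ?_
  rintro y ⟨m, κ, l, -, -, -, -, rfl⟩
  exact (eCoeff_pos _ _ _ _).le

/-- The index `(i_l, μ^l(ν))` for the cube `ν` of scale `mM` and position `κ`. -/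
def subIdx (T : Fin L → Idx N d) (l : Fin L) (m : ℕ) (κ : Fin d → ℤ) : Idx N d :=
  ((T l).1, m * depth T + (T l).2.1, fun t => 2 ^ (T l).2.1 * κ t + (T l).2.2 t)

lemma eCoeff_le_fCoeff (hM : 0 < depth T) (s : ℝ) (p : ℝ≥0∞) {m : ℕ} (hm : 1 ≤ m)
    {κ : Fin d → ℤ} (hκ : κ ∈ boxPos d (m * depth T)) (l : Fin L) :
    eCoeff s p (m * depth T) κ ≤
      fCoeff T s p (subIdx T l m κ).2.1 (subIdx T l m κ).2.2 :=
  le_csSup (finite_fSet hM s p _ _).bddAbove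
    ⟨m, κ, l, hm, mem_boxPos.1 hκ, rfl, fun _ => rfl, rfl⟩

lemma exists_of_fCoeff_ne_zero (hM : 0 < depth T) {s : ℝ} {p : ℝ≥0∞} {j : ℕ} {k : Fin d → ℤ}
    (h : fCoeff T s p j k ≠ 0) :
    ∃ (m : ℕ) (κ : Fin d → ℤ) (l : Fin L), 1 ≤ m ∧ κ ∈ boxPos d (m * depth T) ∧
      j = m * depth T + (T l).2.1 ∧ (∀ t, k t = 2 ^ (T l).2.1 * κ t + (T l).2.2 t) ∧
      fCoeff T s p j k = eCoeff s p (m * depth T) κ := by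
  have hne : (fSet T s p j k).Nonempty := by
    by_contra h0
    rw [Set.not_nonempty_iff_eq_empty] at h0
    exact h (by change sSup (fSet T s p j k) = 0; rw [h0, Real.sSup_empty])
  obtain ⟨m, κ, l, hm, hκ, hj, hk, hy⟩ := hne.csSup_mem (finite_fSet hM s p j k)
  exact ⟨m, κ, l, hm, mem_boxPos.2 hκ, hj, hk, hy⟩

end Covering

/-! ### Compactness in discrete Besov spaces -/

/-- The exponent `p`, replaced by `1` if `p = ∞`. -/
def finExp (p : ℝ≥0∞) : ℝ := if p = ⊤ then 1 else p.toReal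

lemma finExp_pos {p : ℝ≥0∞} (hp : 0 < p) : 0 < finExp p := by
  unfold finExp
  split_ifs with h
  · exact one_pos
  · exact ENNReal.toReal_pos hp.ne' h

lemma ellNorm_mono {ι : Type*} (p : ℝ≥0∞) {f g : ι → ℝ≥0∞} (h : ∀ a, f a ≤ g a) :
    ellNorm p f ≤ ellNorm p g := by
  unfold ellNorm
  split_ifs
  · exact iSup_mono h
  · exact ENNReal.rpow_le_rpow (ENNReal.tsum_le_tsum fun a =>
      ENNReal.rpow_le_rpow (h a) ENNReal.toReal_nonneg) (by positivity)

lemma ellNorm_le {ι : Type*} (p : ℝ≥0∞) (f : ι → ℝ≥0∞) :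
    ellNorm p f ≤ (∑' a, f a ^ finExp p) ^ (1 / finExp p) := by
  unfold ellNorm finExp
  split_ifs
  · simpa using fun a => ENNReal.le_tsum a
  · exact le_rfl

lemma ellNorm_zero {ι : Type*} {p : ℝ≥0∞} (hp : 0 < p) : ellNorm p (fun _ : ι => 0) = 0 := by
  refine le_antisymm ((ellNorm_le p _).trans ?_) zero_le
  have h := finExp_pos hp
  simp [ENNReal.zero_rpow_of_pos h, h]

lemma ellNorm_lt_top {ι : Type*} {p : ℝ≥0∞} (hp : 0 < p) {f : ι → ℝ≥0∞}
    (h : ∑' a, f a ^ finExp p ≠ ⊤) : ellNorm p f < ⊤ :=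
  (ellNorm_le p f).trans_lt
    (ENNReal.rpow_lt_top_of_nonneg (one_div_nonneg.2 (finExp_pos hp).le) h)

/-- Dominated convergence for `ℓ^p` quasi-norms. -/
lemma tendsto_ellNorm_zero {X ι : Type*} [Countable ι] {l : Filter X} [l.IsCountablyGenerated]
    {p : ℝ≥0∞} (hp : 0 < p) {F : X → ι → ℝ≥0∞} {g : ι → ℝ≥0∞}
    (hg : ∑' a, g a ^ finExp p ≠ ⊤) (hFg : ∀ x a, F x a ≤ g a)
    (hF : ∀ a, Tendsto (fun x => F x a) l (𝓝 0)) :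
    Tendsto (fun x => ellNorm p (F x)) l (𝓝 0) := by
  have hr := finExp_pos hp
  have h0 : Tendsto (fun x => ∑' a, F x a ^ finExp p) l (𝓝 0) := by
    let _ : MeasurableSpace ι := ⊤
    have h := tendsto_lintegral_filter_of_dominated_convergence (μ := Measure.count)
      (l := l) (F := fun x a => F x a ^ finExp p) (f := fun _ => 0) (fun a => g a ^ finExp p)
      (Eventually.of_forall fun x => measurable_from_top)
      (Eventually.of_forall fun x => Eventually.of_forall fun a =>
        ENNReal.rpow_le_rpow (hFg x a) hr.le)
      (by rwa [lintegral_count])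
      (Eventually.of_forall fun a => by
        have := ((ENNReal.continuous_rpow_const (y := finExp p)).tendsto 0).comp (hF a)
        simpa [ENNReal.zero_rpow_of_pos hr, Function.comp_def] using this)
    simpa [lintegral_count] using h
  have h1 := ((ENNReal.continuous_rpow_const (y := 1 / finExp p)).tendsto 0).comp h0
  rw [ENNReal.zero_rpow_of_pos (one_div_pos.2 hr)] at h1
  exact tendsto_of_tendsto_of_tendsto_of_le_of_le tendsto_const_nhds h1
    (fun _ => zero_le) fun x => ellNorm_le p _

section Scale

variable {N d L : ℕ} {T : Fin L → Idx N d}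

/-- A sum over the cubes of scale `j` of a function of `f_λ` is controlled by a sum of the same
function of the `e_ν` over the cubes of one scale. -/
lemma tsum_fCoeff_le (hM : 0 < depth T) (hpos : ∀ l, 0 < (T l).2.1) (s : ℝ) (p : ℝ≥0∞) (j : ℕ)
    {φ : ℝ → ℝ≥0∞} (hφ : φ 0 = 0) :
    ∑' k : Fin d → ℤ, φ (fCoeff T s p j k) ≤
      L * ∑ κ ∈ boxPos d ((j - 1) / depth T * depth T),
        φ (eCoeff s p ((j - 1) / depth T * depth T) κ) := by
  classical
  set u := (j - 1) / depth T * depth T with hu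
  let Φ : Fin L × boxPos d u → (Fin d → ℤ) := fun z t => 2 ^ (T z.1).2.1 * z.2.1 t + (T z.1).2.2 t
  calc ∑' k : Fin d → ℤ, φ (fCoeff T s p j k)
      ≤ ∑' k : Fin d → ℤ, ∑' z : Fin L × boxPos d u,
          if k = Φ z then φ (eCoeff s p u z.2.1) else 0 := by
        refine ENNReal.tsum_le_tsum fun k => ?_
        by_cases h0 : fCoeff T s p j k = 0
        · simp [h0, hφ]
        obtain ⟨m, κ, l, hm, hκ, hj, hk, hf⟩ := exists_of_fCoeff_ne_zero hM h0
        have hmu : (j - 1) / depth T = m := by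
          have h1 := hpos l
          have h2 := le_depth T l
          refine Nat.div_eq_of_lt_le (by omega) ?_
          rw [Nat.succ_mul]; omega
        have hmu' : m * depth T = u := by rw [hu, hmu]
        rw [hmu'] at hκ hf
        refine le_trans ?_ (ENNReal.le_tsum (⟨l, κ, hκ⟩ : Fin L × boxPos d u))
        rw [if_pos (funext hk), hf]
    _ = ∑' z : Fin L × boxPos d u, φ (eCoeff s p u z.2.1) := by
        rw [ENNReal.tsum_comm]
        simp_rw [tsum_ite_eq]
    _ = L * ∑ κ ∈ boxPos d u, φ (eCoeff s p u κ) := by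
        rw [tsum_fintype, Fintype.sum_prod_type]
        simp only [Finset.sum_const, Finset.card_univ, Fintype.card_fin, nsmul_eq_mul]
        rw [← Finset.sum_coe_sort (boxPos d u)]

/-- The weighted `f_λ` of one scale. -/
def fScale (T : Fin L → Idx N d) (s : ℝ) (p : ℝ≥0∞) (B : ℝ) (j : ℕ)
    (ik : Fin N × (Fin d → ℤ)) : ℝ≥0∞ :=
  ENNReal.ofReal (B * fCoeff T s p j ik.2 * (2 : ℝ) ^ ((s - dOver d p) * (j : ℝ)))

lemma tsum_fScale_le (hM : 0 < depth T) (hpos : ∀ l, 0 < (T l).2.1) (s : ℝ) (p : ℝ≥0∞) (B : ℝ)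
    (j : ℕ) {r : ℝ} (hr : 0 < r) :
    ∑' ik, fScale T s p B j ik ^ r ≤ N * (L * ∑ κ ∈ boxPos d ((j - 1) / depth T * depth T),
      ENNReal.ofReal (B * eCoeff s p ((j - 1) / depth T * depth T) κ *
        (2 : ℝ) ^ ((s - dOver d p) * (j : ℝ))) ^ r) := by
  have h := tsum_fCoeff_le hM hpos s p j
    (φ := fun y => ENNReal.ofReal (B * y * (2 : ℝ) ^ ((s - dOver d p) * (j : ℝ))) ^ r)
    (by simp [hr])
  rw [ENNReal.tsum_prod']
  simp only [fScale]
  rw [tsum_fintype, Finset.sum_const, Finset.card_univ, Fintype.card_fin, nsmul_eq_mul]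
  gcongr

lemma tsum_fScale_ne_top (hM : 0 < depth T) (hpos : ∀ l, 0 < (T l).2.1) (s : ℝ) (p : ℝ≥0∞) (B : ℝ)
    (j : ℕ) {r : ℝ} (hr : 0 < r) : ∑' ik, fScale T s p B j ik ^ r ≠ ⊤ := by
  refine ne_top_of_le_ne_top ?_ (tsum_fScale_le hM hpos s p B j hr)
  refine ENNReal.mul_ne_top (ENNReal.natCast_ne_top _) (ENNReal.mul_ne_top
    (ENNReal.natCast_ne_top _) (ENNReal.sum_ne_top.2 fun κ _ => ?_))
  exact ENNReal.rpow_ne_top_of_nonneg hr.le ENNReal.ofReal_ne_top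

/-- A weighted `e_ν`, in terms of the irreducible scale. -/
lemma eCoeff_weighted_le (s : ℝ) (p : ℝ≥0∞) {B : ℝ} (hB : 0 ≤ B) {j u M : ℕ} (huj : u ≤ j)
    (hju : j ≤ u + M) (κ : Fin d → ℤ) :
    B * eCoeff s p u κ * (2 : ℝ) ^ ((s - dOver d p) * (j : ℝ)) ≤
      B * (2 : ℝ) ^ (|s - dOver d p| * M) * (2 : ℝ) ^ (-(Real.log u) ^ 2) *
        (2 : ℝ) ^ (-(dOver d p) * (irredScale u κ : ℝ)) := by
  rw [eCoeff_eq, mul_assoc, mul_assoc, mul_assoc, ← Real.rpow_add two_pos, ← Real.rpow_add two_pos,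
    ← Real.rpow_add two_pos]
  refine mul_le_mul_of_nonneg_left (Real.rpow_le_rpow_of_exponent_le one_le_two ?_) hB
  have h1 : (s - dOver d p) * ((j : ℝ) - u) ≤ |s - dOver d p| * M := by
    have h2 : (0 : ℝ) ≤ (j : ℝ) - u := sub_nonneg.2 (by exact_mod_cast huj)
    have h3 : (j : ℝ) - u ≤ M := by
      rw [sub_le_iff_le_add']; exact_mod_cast hju
    exact (mul_le_mul_of_nonneg_right (le_abs_self _) h2).trans
      (mul_le_mul_of_nonneg_left h3 (abs_nonneg _))
  linarith

lemma ellNorm_fScale_le_rpow_mul (hM : 0 < depth T) (hpos : ∀ l, 0 < (T l).2.1) (s : ℝ) {p : ℝ≥0∞}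
    (hp : 0 < p) {B : ℝ} (hB : 0 ≤ B) {j u : ℕ} (hu : u = (j - 1) / depth T * depth T) (hj : 1 ≤ j) :
    ellNorm p (fScale T s p B j) ≤ ENNReal.ofReal (
      ((N + 1) * (L + 1) * (u + 1 : ℝ)) ^ (1 / finExp p) *
      (B * (2 : ℝ) ^ (|s - dOver d p| * depth T) * (2 : ℝ) ^ (-(Real.log u) ^ 2))) := by
  set W := B * (2 : ℝ) ^ (|s - dOver d p| * depth T) * (2 : ℝ) ^ (-(Real.log u) ^ 2) with hW
  have hW0 : 0 ≤ W := by positivity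
  have huj : u ≤ j := by
    rw [hu]; exact (Nat.div_mul_le_self _ _).trans (Nat.sub_le _ _)
  have hju : j ≤ u + depth T := by
    have h1 := Nat.lt_div_mul_add (a := j - 1) hM
    omega
  by_cases htop : p = ⊤
  · subst htop
    have h1 : (1 : ℝ) ≤ ((N + 1) * (L + 1) * (u + 1 : ℝ)) ^ (1 / finExp ⊤) := by
      refine Real.one_le_rpow ?_ (one_div_nonneg.2 (finExp_pos hp).le)
      have : (1 : ℝ) ≤ (N + 1) * (L + 1) := by
        nlinarith [(Nat.cast_nonneg N : (0 : ℝ) ≤ N), (Nat.cast_nonneg L : (0 : ℝ) ≤ L),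
          mul_nonneg (Nat.cast_nonneg N : (0 : ℝ) ≤ N) (Nat.cast_nonneg L : (0 : ℝ) ≤ L)]
      nlinarith [(Nat.cast_nonneg u : (0 : ℝ) ≤ u)]
    rw [ellNorm, if_pos rfl]
    refine iSup_le fun ik => ENNReal.ofReal_le_ofReal (le_trans ?_ (le_mul_of_one_le_left hW0 h1))
    by_cases h0 : fCoeff T s ⊤ j ik.2 = 0
    · simpa [h0] using hW0
    obtain ⟨m, κ, l, hm, hκ, hjm, hk, hf⟩ := exists_of_fCoeff_ne_zero hM h0
    have hmu' : m * depth T = u := by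
      rw [hu]
      congr 1
      have h1 := hpos l
      have h2 := le_depth T l
      refine (Nat.div_eq_of_lt_le (by omega) ?_).symm
      rw [Nat.succ_mul]; omega
    rw [hf, hmu']
    refine (eCoeff_weighted_le s ⊤ hB huj hju κ).trans (le_of_eq ?_)
    simp [dOver_top, hW]
  · have hr : finExp p = p.toReal := if_neg htop
    have hr0 : 0 < p.toReal := ENNReal.toReal_pos hp.ne' htop
    have hdr : dOver d p * p.toReal = d := by rw [dOver_eq]; field_simp
    have key : ∑' ik, fScale T s p B j ik ^ p.toReal ≤
        ENNReal.ofReal ((N + 1) * (L + 1) * (u + 1 : ℝ) * W ^ p.toReal) := by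
      refine (tsum_fScale_le hM hpos s p B j hr0).trans ?_
      rw [← hu]
      have h1 : ∑ κ ∈ boxPos d u, ENNReal.ofReal (B * eCoeff s p u κ *
          (2 : ℝ) ^ ((s - dOver d p) * (j : ℝ))) ^ p.toReal ≤
          ENNReal.ofReal ((u + 1 : ℝ) * W ^ p.toReal) := by
        calc _ ≤ ∑ κ ∈ boxPos d u, ENNReal.ofReal (W ^ p.toReal *
              (2 : ℝ) ^ (-(d : ℝ) * (irredScale u κ : ℝ))) := by
              refine Finset.sum_le_sum fun κ _ => ?_
              have he : 0 ≤ B * eCoeff s p u κ * (2 : ℝ) ^ ((s - dOver d p) * (j : ℝ)) :=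
                mul_nonneg (mul_nonneg hB (eCoeff_pos _ _ _ _).le) (by positivity)
              rw [ENNReal.ofReal_rpow_of_nonneg he hr0.le]
              refine ENNReal.ofReal_le_ofReal ((Real.rpow_le_rpow he
                (eCoeff_weighted_le s p hB huj hju κ) hr0.le).trans (le_of_eq ?_))
              rw [Real.mul_rpow hW0 (by positivity), ← Real.rpow_mul two_pos.le]
              congr 2
              rw [← hdr]; ring
          _ = ENNReal.ofReal (W ^ p.toReal *
                ∑ κ ∈ boxPos d u, (2 : ℝ) ^ (-(d : ℝ) * (irredScale u κ : ℝ))) := by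
              rw [Finset.mul_sum, ENNReal.ofReal_sum_of_nonneg]
              intro κ _; positivity
          _ ≤ _ := by
              refine ENNReal.ofReal_le_ofReal ?_
              rw [mul_comm]
              exact mul_le_mul_of_nonneg_right (sum_boxPos_irredScale_le d u) (by positivity)
      calc _ ≤ ENNReal.ofReal (N + 1) * (ENNReal.ofReal (L + 1) *
            ENNReal.ofReal ((u + 1 : ℝ) * W ^ p.toReal)) := by
            gcongr
            · rw [← ENNReal.ofReal_natCast]; exact ENNReal.ofReal_le_ofReal (by linarith)
            · rw [← ENNReal.ofReal_natCast]; exact ENNReal.ofReal_le_ofReal (by linarith)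
        _ = _ := by
            rw [← ENNReal.ofReal_mul (by positivity), ← ENNReal.ofReal_mul (by positivity)]
            congr 1; ring
    rw [ellNorm, if_neg htop, hr]
    refine (ENNReal.rpow_le_rpow key (by positivity)).trans (le_of_eq ?_)
    rw [ENNReal.ofReal_rpow_of_nonneg (by positivity) (by positivity),
      Real.mul_rpow (by positivity) (by positivity), ← Real.rpow_mul hW0,
      mul_one_div_cancel hr0.ne', Real.rpow_one]

/-- The norms of the scales of `f` decay faster than every power of the scale. -/
lemma ellNorm_fScale_le (hM : 0 < depth T) (hpos : ∀ l, 0 < (T l).2.1) (s : ℝ) {p : ℝ≥0∞}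
    (hp : 0 < p) {B : ℝ} (hB : 0 ≤ B) {ρ : ℝ} (hρ : 0 ≤ ρ) :
    ∃ C : ℝ, 0 ≤ C ∧ ∀ j : ℕ, ellNorm p (fScale T s p B j) ≤
      ENNReal.ofReal (C * (j + 1 : ℝ) ^ (-ρ)) := by
  set r := 1 / finExp p with hr
  have hr0 : 0 ≤ r := one_div_nonneg.2 (finExp_pos hp).le
  obtain ⟨C, hC, h⟩ := two_rpow_neg_sq_log_le (r + ρ)
  refine ⟨((N + 1) * (L + 1) * 2 : ℝ) ^ r * (B * (2 : ℝ) ^ (|s - dOver d p| * depth T) * C) *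
    (depth T + 2 : ℝ) ^ ρ, by positivity, fun j => ?_⟩
  by_cases h0 : ∀ k, fCoeff T s p j k = 0
  · have : fScale T s p B j = fun _ => 0 := by
      ext ik; simp [fScale, h0]
    rw [this, ellNorm_zero hp]
    exact zero_le
  push Not at h0
  obtain ⟨k, hk⟩ := h0
  obtain ⟨m, κ, l, hm, hκ, hjm, -, -⟩ := exists_of_fCoeff_ne_zero hM hk
  have hl := hpos l
  have hl' := le_depth T l
  set u := m * depth T with hu
  have hu' : u = (j - 1) / depth T * depth T := by
    rw [hu]; congr 1
    refine (Nat.div_eq_of_lt_le (by omega) ?_).symm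
    rw [Nat.succ_mul]; omega
  have hu1 : 1 ≤ u := Nat.mul_pos hm hM
  refine (ellNorm_fScale_le_rpow_mul hM hpos s hp hB hu' (by omega)).trans
    (ENNReal.ofReal_le_ofReal ?_)
  have hu0 : (1 : ℝ) ≤ u := by exact_mod_cast hu1
  have hupos : (0 : ℝ) < u := by linarith
  have hjR : (j : ℝ) ≤ u + depth T := by rw [hjm]; push_cast; gcongr
  have hMR : (0 : ℝ) ≤ depth T := Nat.cast_nonneg _
  have h1 : ((N + 1) * (L + 1) * (u + 1 : ℝ)) ^ r ≤ ((N + 1) * (L + 1) * 2 : ℝ) ^ r * (u : ℝ) ^ r := by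
    rw [← Real.mul_rpow (by positivity) (by positivity)]
    refine Real.rpow_le_rpow (by positivity) ?_ hr0
    rw [mul_assoc _ (2 : ℝ)]
    gcongr
    linarith
  have h2 : (u : ℝ) ^ (-ρ) ≤ (depth T + 2 : ℝ) ^ ρ * (j + 1 : ℝ) ^ (-ρ) := by
    have h3 : (j + 1 : ℝ) ≤ (depth T + 2) * u := by nlinarith
    have h4 := Real.rpow_le_rpow (by positivity) h3 hρ
    rw [Real.mul_rpow (by positivity) (by positivity)] at h4
    rw [Real.rpow_neg (by positivity), Real.rpow_neg (by positivity), ← div_eq_mul_inv,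
      inv_eq_one_div, div_le_div_iff₀ (by positivity) (by positivity), one_mul]
    exact h4
  calc _ ≤ (((N + 1) * (L + 1) * 2 : ℝ) ^ r * (u : ℝ) ^ r) *
        (B * (2 : ℝ) ^ (|s - dOver d p| * depth T) * (C * (u : ℝ) ^ (-(r + ρ)))) := by
        gcongr
        exact h u hupos
    _ = ((N + 1) * (L + 1) * 2 : ℝ) ^ r * (B * (2 : ℝ) ^ (|s - dOver d p| * depth T) * C) *
          ((u : ℝ) ^ r * (u : ℝ) ^ (-(r + ρ))) := by ring
    _ = ((N + 1) * (L + 1) * 2 : ℝ) ^ r * (B * (2 : ℝ) ^ (|s - dOver d p| * depth T) * C) *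
          (u : ℝ) ^ (-ρ) := by
        rw [← Real.rpow_add hupos]; congr 2; ring
    _ ≤ _ := by
        rw [mul_assoc _ ((depth T + 2 : ℝ) ^ ρ)]
        gcongr

lemma tsum_ellNorm_fScale_ne_top (hM : 0 < depth T) (hpos : ∀ l, 0 < (T l).2.1) (s : ℝ)
    {p : ℝ≥0∞} (hp : 0 < p) {B : ℝ} (hB : 0 ≤ B) {r : ℝ} (hr : 0 < r) :
    ∑' j, ellNorm p (fScale T s p B j) ^ r ≠ ⊤ := by
  obtain ⟨C, hC, h⟩ := ellNorm_fScale_le hM hpos s hp hB (ρ := 2 / r) (by positivity)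
  have hs : Summable fun j : ℕ => C ^ r * (((j + 1 : ℕ) : ℝ) ^ 2)⁻¹ :=
    ((summable_nat_add_iff 1).2 (Real.summable_nat_pow_inv.2 (by norm_num : 1 < 2))).mul_left _
  refine ne_top_of_le_ne_top hs.tsum_ofReal_ne_top (ENNReal.tsum_le_tsum fun j => ?_)
  refine (ENNReal.rpow_le_rpow (h j) hr.le).trans (le_of_eq ?_)
  rw [ENNReal.ofReal_rpow_of_nonneg (by positivity) hr.le, Real.mul_rpow hC (by positivity),
    ← Real.rpow_mul (by positivity)]
  congr 2
  rw [show -(2 / r) * r = -(2 : ℕ) by push_cast; field_simp, Real.rpow_neg (by positivity),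
    Real.rpow_natCast]
  push_cast
  rfl

lemma ofReal_le_fScale {s : ℝ} {p : ℝ≥0∞} {B : ℝ} {c : Idx N d → ℝ}
    (hc : ∀ a, |c a| ≤ B * fCoeff T s p a.2.1 a.2.2) (j : ℕ) (ik : Fin N × (Fin d → ℤ)) :
    ENNReal.ofReal |c (ik.1, j, ik.2) * (2 : ℝ) ^ ((s - dOver d p) * (j : ℝ))| ≤
      fScale T s p B j ik := by
  refine ENNReal.ofReal_le_ofReal ?_
  rw [abs_mul, abs_of_pos (by positivity : (0 : ℝ) < (2 : ℝ) ^ ((s - dOver d p) * (j : ℝ)))]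
  exact mul_le_mul_of_nonneg_right (hc _) (by positivity)

lemma besovNorm_lt_top (hM : 0 < depth T) (hpos : ∀ l, 0 < (T l).2.1) {s : ℝ} {p q : ℝ≥0∞}
    (hp : 0 < p) (hq : 0 < q) {B : ℝ} (hB : 0 ≤ B) {c : Idx N d → ℝ}
    (hc : ∀ a, |c a| ≤ B * fCoeff T s p a.2.1 a.2.2) : besovNorm s p q c < ⊤ :=
  (ellNorm_mono q fun j => ellNorm_mono p fun ik => ofReal_le_fScale hc j ik).trans_lt
    (ellNorm_lt_top hq (tsum_ellNorm_fScale_ne_top hM hpos s hp hB (finExp_pos hq)))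

/-- The sequences dominated by `f` form a compact subset of the Besov space. -/
lemma exists_isCompact_dominated (hM : 0 < depth T) (hpos : ∀ l, 0 < (T l).2.1) (s : ℝ)
    {p q : ℝ≥0∞} (hp : 0 < p) (hq : 0 < q) :
    ∃ K : Set (Besov N d s p q), IsCompact K ∧
      ∀ c : Idx N d → ℝ, (∀ a, |c a| ≤ fCoeff T s p a.2.1 a.2.2) → c ∈ Subtype.val '' K := by
  let box : Set (Idx N d → ℝ) := Set.univ.pi fun a =>
    Set.Icc (-fCoeff T s p a.2.1 a.2.2) (fCoeff T s p a.2.1 a.2.2)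
  have hbox : ∀ c ∈ box, ∀ a, |c a| ≤ fCoeff T s p a.2.1 a.2.2 := fun c hc a =>
    abs_le.2 (hc a (mem_univ a))
  have hcomp : IsCompact box := isCompact_univ_pi fun a => isCompact_Icc
  have : CompactSpace box := isCompact_iff_compactSpace.1 hcomp
  let F : box → Besov N d s p q := fun c =>
    ⟨c.1, besovNorm_lt_top hM hpos hp hq zero_le_one (by simpa using hbox c.1 c.2)⟩
  have hF : Continuous F := by
    refine ⟨fun U hU => isOpen_iff_mem_nhds.2 fun c hc => ?_⟩
    obtain ⟨r, hr, hrU⟩ := hU (F c) hc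
    have hlim : Tendsto (fun c' : box => besovNorm s p q (c'.1 - c.1)) (𝓝 c) (𝓝 0) := by
      have hdom : ∀ c' : box, ∀ a, |(c'.1 - c.1) a| ≤ 2 * fCoeff T s p a.2.1 a.2.2 := fun c' a => by
        have := abs_sub (c'.1 a) (c.1 a)
        have h1 := hbox _ c'.2 a
        have h2 := hbox _ c.2 a
        simp only [Pi.sub_apply]
        linarith
      refine tendsto_ellNorm_zero hq (g := fun j => ellNorm p (fScale T s p 2 j))
        (tsum_ellNorm_fScale_ne_top hM hpos s hp zero_le_two (finExp_pos hq))
        (fun c' j => ellNorm_mono p fun ik => ofReal_le_fScale (hdom c') j ik) fun j => ?_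
      refine tendsto_ellNorm_zero hp (g := fScale T s p 2 j)
        (tsum_fScale_ne_top hM hpos s p 2 j (finExp_pos hp))
        (fun c' ik => ofReal_le_fScale (hdom c') j ik) fun ik => ?_
      have hcont : Continuous fun c' : box => ENNReal.ofReal
          |(c'.1 - c.1) (ik.1, j, ik.2) * (2 : ℝ) ^ ((s - dOver d p) * (j : ℝ))| := by
        simp only [Pi.sub_apply]
        refine ENNReal.continuous_ofReal.comp (Continuous.abs (Continuous.mul ?_ continuous_const))
        exact ((continuous_apply _).comp continuous_subtype_val).sub continuous_const
      simpa using hcont.tendsto c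
    filter_upwards [hlim.eventually (gt_mem_nhds hr)] with c' hc'
    exact hrU (F c') hc'
  refine ⟨Set.range F, isCompact_range hF, fun c hc => ?_⟩
  exact ⟨F ⟨c, fun a _ => abs_le.1 (hc a)⟩, ⟨_, rfl⟩, rfl⟩

end Scale

/-! ### The cube of a given scale that contains a point -/

/-- The position of the dyadic cube of scale `j` that contains `x`. -/
def cubePos {d : ℕ} (j : ℕ) (x : E d) : Fin d → ℤ := fun t => ⌊(2 : ℝ) ^ j * x t⌋

lemma cubePos_mem_boxPos {d : ℕ} {x : E d} (hx : x ∈ unitCube d) (j : ℕ) :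
    cubePos j x ∈ boxPos d j := by
  refine mem_boxPos.2 fun t => ⟨Int.floor_nonneg.2 (mul_nonneg (by positivity) (hx t).1), ?_⟩
  refine Int.floor_lt.2 ?_
  push_cast
  exact mul_lt_of_lt_one_right (by positivity) (hx t).2

lemma cubePos_add_div {d : ℕ} (x : E d) (j i : ℕ) (t : Fin d) :
    cubePos (j + i) x t / 2 ^ i = cubePos j x t := by
  have h := Int.floor_div_natCast ((2 : ℝ) ^ (j + i) * x t) (2 ^ i)
  push_cast at h
  rw [cubePos, ← h, cubePos]
  congr 1
  rw [pow_add]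
  field_simp

lemma exists_le_norm_wavelet_subIdx {𝕜 : Type*} [RCLike 𝕜] {N d L : ℕ} {T : Fin L → Idx N d}
    {ψ : Fin N → E d → 𝕜} {C₀ : ℝ} (h : ∀ x ∈ unitCube d, ∃ l, C₀ ≤ ‖wavelet ψ (T l) x‖)
    (x : E d) (m : ℕ) :
    ∃ l, C₀ ≤ ‖wavelet ψ (subIdx T l m (cubePos (m * depth T) x)) x‖ := by
  obtain ⟨l, hl⟩ := h (WithLp.toLp 2 fun t => Int.fract ((2 : ℝ) ^ (m * depth T) * x t))
    fun t => ⟨Int.fract_nonneg _, Int.fract_lt_one _⟩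
  refine ⟨l, hl.trans (le_of_eq ?_)⟩
  unfold wavelet subIdx cubePos
  congr 3
  ext t
  simp only [Int.fract]
  push_cast
  rw [pow_add]
  ring

/-! ### Random coefficients -/

section Random

variable {Ω : Type*} [MeasurableSpace Ω] {P : Measure Ω}

lemma measure_abs_lt_le {X : Ω → ℝ} (hX : pdf.IsUniform X (Set.Icc (-1) 1) P volume) {r : ℝ}
    (hr : 0 ≤ r) : P {ω | |X ω| < r} ≤ ENNReal.ofReal r := by
  have h0 : (volume (Set.Icc (-1 : ℝ) 1)) ≠ 0 := by simp
  have h1 : (volume (Set.Icc (-1 : ℝ) 1)) ≠ ⊤ := by simp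
  have hs : {ω | |X ω| < r} = X ⁻¹' Set.Ioo (-r) r := by
    ext ω; simp [abs_lt]
  rw [hs, hX.measure_preimage h0 h1 measurableSet_Ioo]
  refine ENNReal.div_le_of_le_mul ((measure_mono Set.inter_subset_right).trans ?_)
  rw [Real.volume_Ioo, Real.volume_Icc, ← ENNReal.ofReal_mul hr]
  exact ENNReal.ofReal_le_ofReal (by linarith)

lemma ae_mem_Icc_of_isUniform {X : Ω → ℝ} (hX : pdf.IsUniform X (Set.Icc (-1) 1) P volume) :
    ∀ᵐ ω ∂P, X ω ∈ Set.Icc (-1 : ℝ) 1 := by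
  have h0 : (volume (Set.Icc (-1 : ℝ) 1)) ≠ 0 := by simp
  have h1 : (volume (Set.Icc (-1 : ℝ) 1)) ≠ ⊤ := by simp
  have h : P (X ⁻¹' (Set.Icc (-1 : ℝ) 1)ᶜ) = 0 := by
    rw [hX.measure_preimage h0 h1 measurableSet_Icc.compl]
    simp
  exact h

variable {N d L : ℕ} {T : Fin L → Idx N d} {ξ : Idx N d → Ω → ℝ}

/-- The position of the ancestor of scale `(m + i) M` of a cube of scale `(m + W) M`. -/
def ancestorPos (M W i : ℕ) (κ : Fin d → ℤ) : Fin d → ℤ := fun t => κ t / 2 ^ ((W - i) * M)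

lemma ancestorPos_cubePos {M W m i : ℕ} (hi : i < W) (x : E d) :
    ancestorPos M W i (cubePos ((m + W) * M) x) = cubePos ((m + i) * M) x := by
  ext t
  have h : (m + W) * M = (m + i) * M + (W - i) * M := by
    rw [← add_mul]; congr 1; omega
  rw [ancestorPos, h, cubePos_add_div]

lemma measure_all_small_le (hpos : ∀ l, 0 < (T l).2.1) [IsProbabilityMeasure P]
    (hξi : iIndepFun ξ P)
    (hξu : ∀ a, pdf.IsUniform (ξ a) (Set.Icc (-1) 1) P volume) {ε : ℝ} (hε : 0 < ε) (W m : ℕ)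
    (κ : Fin W → Fin d → ℤ) (σ : Fin W → Fin L) :
    P (⋂ i : Fin W, {ω | |ξ (subIdx T (σ i) (m + i) (κ i)) ω| < (2 : ℝ) ^ (-ε * ((m + i : ℕ) : ℝ))})
      ≤ ENNReal.ofReal ((2 : ℝ) ^ (-(ε * W) * m)) := by
  have hinj : Function.Injective fun i : Fin W => subIdx T (σ i) (m + i) (κ i) := by
    intro i i' h
    have h2 : (m + i) * depth T + (T (σ i)).2.1 = (m + i') * depth T + (T (σ i')).2.1 :=
      congrArg (fun a : Idx N d => a.2.1) h
    have hl := hpos (σ i)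
    have hl' := hpos (σ i')
    have hd1 := le_depth T (σ i)
    have hd2 := le_depth T (σ i')
    ext
    rcases lt_trichotomy (i : ℕ) i' with hlt | heq | hgt
    · have : (m + i + 1) * depth T ≤ (m + i') * depth T := Nat.mul_le_mul_right _ (by omega)
      rw [Nat.succ_mul] at this; omega
    · exact heq
    · have : (m + i' + 1) * depth T ≤ (m + i) * depth T := Nat.mul_le_mul_right _ (by omega)
      rw [Nat.succ_mul] at this; omega
  have hind := hξi.precomp hinj
  rw [hind.meas_iInter]
  · calc _ ≤ ∏ i : Fin W, ENNReal.ofReal ((2 : ℝ) ^ (-ε * (m : ℝ))) := by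
          refine Finset.prod_le_prod' fun i _ => (measure_abs_lt_le (hξu _) (by positivity)).trans
            (ENNReal.ofReal_le_ofReal (Real.rpow_le_rpow_of_exponent_le one_le_two ?_))
          push_cast
          nlinarith [(Nat.cast_nonneg (i : ℕ) : (0 : ℝ) ≤ ((i : ℕ) : ℝ))]
      _ = _ := by
          rw [Finset.prod_const, Finset.card_univ, Fintype.card_fin,
            ← ENNReal.ofReal_pow (by positivity), ← Real.rpow_natCast, ← Real.rpow_mul two_pos.le]
          congr 2; ring
  · intro i
    refine ⟨{y | |y| < (2 : ℝ) ^ (-ε * ((m + i : ℕ) : ℝ))}, ?_, rfl⟩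
    exact measurableSet_lt measurable_abs measurable_const

/-- Almost surely, along every chain of nested cubes, coefficients which are not small occur in every
window of a fixed length. -/
lemma ae_eventually_exists_large (hpos : ∀ l, 0 < (T l).2.1) [IsProbabilityMeasure P]
    (hξi : iIndepFun ξ P)
    (hξu : ∀ a, pdf.IsUniform (ξ a) (Set.Icc (-1) 1) P volume) {ε : ℝ} (hε : 0 < ε) :
    ∃ W : ℕ, ∀ᵐ ω ∂P, ∀ᶠ m : ℕ in atTop, ∀ κ ∈ boxPos d ((m + W) * depth T),
      ∀ σ : Fin W → Fin L, ∃ i : Fin W, (2 : ℝ) ^ (-ε * ((m + i : ℕ) : ℝ)) ≤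
        |ξ (subIdx T (σ i) (m + i) (ancestorPos (depth T) W i κ)) ω| := by
  obtain ⟨W, hW⟩ := exists_nat_ge ((d * depth T + 1 : ℝ) / ε)
  rw [div_le_iff₀ hε] at hW
  refine ⟨W, ?_⟩
  let bad : ℕ → Set Ω := fun m => ⋃ κ ∈ boxPos d ((m + W) * depth T), ⋃ σ : Fin W → Fin L,
    ⋂ i : Fin W, {ω | |ξ (subIdx T (σ i) (m + i) (ancestorPos (depth T) W i κ)) ω| <
      (2 : ℝ) ^ (-ε * ((m + i : ℕ) : ℝ))}
  have hbad : ∀ m, P (bad m) ≤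
      ENNReal.ofReal ((2 : ℝ) ^ (d * (W * depth T)) * (L : ℝ) ^ W * (1 / 2) ^ m) := fun m => by
    calc P (bad m) ≤ ∑ κ ∈ boxPos d ((m + W) * depth T), ∑ σ : Fin W → Fin L,
          ENNReal.ofReal ((2 : ℝ) ^ (-(ε * W) * m)) := by
          refine (measure_biUnion_finset_le _ _).trans (Finset.sum_le_sum fun κ _ => ?_)
          refine (measure_iUnion_fintype_le _ _).trans (Finset.sum_le_sum fun σ _ => ?_)
          exact measure_all_small_le hpos hξi hξu hε W m _ σ
      _ = ENNReal.ofReal ((2 : ℝ) ^ (d * ((m + W) * depth T)) * (L : ℝ) ^ W *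
            (2 : ℝ) ^ (-(ε * W) * m)) := by
          rw [Finset.sum_const, Finset.sum_const, card_boxPos, Finset.card_univ, Fintype.card_fun,
            Fintype.card_fin, Fintype.card_fin, nsmul_eq_mul, nsmul_eq_mul, ← mul_assoc,
            ENNReal.ofReal_mul (by positivity), ENNReal.ofReal_mul (by positivity)]
          congr 2
          · rw [← ENNReal.ofReal_natCast]; push_cast; rfl
          · rw [← ENNReal.ofReal_natCast]; push_cast; rfl
      _ ≤ _ := by
          refine ENNReal.ofReal_le_ofReal ?_
          have h1 : (2 : ℝ) ^ (d * ((m + W) * depth T)) =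
              (2 : ℝ) ^ (d * (W * depth T)) * (2 : ℝ) ^ ((d * depth T : ℝ) * m) := by
            rw [← Real.rpow_natCast, ← Real.rpow_natCast, ← Real.rpow_add two_pos]
            congr 1; push_cast; ring
          have h2 : ((1 : ℝ) / 2) ^ m = (2 : ℝ) ^ (-(1 : ℝ) * m) := by
            rw [Real.rpow_mul zero_le_two, Real.rpow_neg_one, Real.rpow_natCast, one_div]
          have h3 : (2 : ℝ) ^ ((d * depth T : ℝ) * m) * (2 : ℝ) ^ (-(ε * W) * m) ≤
              (2 : ℝ) ^ (-(1 : ℝ) * m) := by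
            rw [← Real.rpow_add two_pos]
            refine Real.rpow_le_rpow_of_exponent_le one_le_two ?_
            nlinarith [(Nat.cast_nonneg m : (0 : ℝ) ≤ m)]
          rw [h1, h2]
          calc _ = (2 : ℝ) ^ (d * (W * depth T)) * (L : ℝ) ^ W *
                ((2 : ℝ) ^ ((d * depth T : ℝ) * m) * (2 : ℝ) ^ (-(ε * W) * m)) := by ring
            _ ≤ _ := mul_le_mul_of_nonneg_left h3 (by positivity)
  have hsum : ∑' m, P (bad m) ≠ ⊤ := by
    refine ne_top_of_le_ne_top (Summable.tsum_ofReal_ne_top ?_) (ENNReal.tsum_le_tsum hbad)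
    exact (summable_geometric_of_lt_one (by norm_num) (by norm_num)).mul_left _
  filter_upwards [ae_eventually_notMem hsum] with ω hω
  filter_upwards [hω] with m hm κ hκ σ
  by_contra! hcon
  exact hm (mem_iUnion₂.2 ⟨κ, hκ, mem_iUnion.2 ⟨σ, mem_iInter.2 hcon⟩⟩)

end Random

/-! ### Lower bounds for the divergence exponent -/

section Rate

variable {𝕜 : Type*} [RCLike 𝕜] {N d L : ℕ} {ψ : Fin N → E d → 𝕜} {T : Fin L → Idx N d}

lemma le_divExponent {c : Idx N d → ℝ} {x : E d} {Γ : ℝ}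
    (h : ∀ γ < Γ, DivergesAtRate ψ c γ x) : (Γ : EReal) ≤ divExponent ψ c x := by
  refine le_of_forall_lt fun z hz => ?_
  obtain ⟨γ, hzγ, hγ⟩ := EReal.lt_iff_exists_real_btwn.1 hz
  exact hzγ.trans_le (le_iSup₂ (f := fun (γ : ℝ) (_ : DivergesAtRate ψ c γ x) => (γ : EReal))
    γ (h γ (EReal.coe_lt_coe_iff.1 hγ)))

lemma divExponent_le {c : Idx N d → ℝ} {x : E d} {Γ : ℝ}
    (h : ∀ γ > Γ, ¬ DivergesAtRate ψ c γ x) : divExponent ψ c x ≤ (Γ : EReal) := by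
  refine iSup₂_le fun γ hγ => ?_
  by_contra hlt
  exact h γ (EReal.coe_lt_coe_iff.1 (not_le.1 hlt)) hγ

lemma DivergesAtRate.mono {c : Idx N d → ℝ} {x : E d} {γ γ' : ℝ} (hγ : γ' ≤ γ)
    (h : DivergesAtRate ψ c γ x) : DivergesAtRate ψ c γ' x := by
  obtain ⟨C, hC, a, ha, hb⟩ := h
  refine ⟨C, hC, a, ha, fun n => (mul_le_mul_of_nonneg_left ?_ hC.le).trans (hb n)⟩
  exact Real.rpow_le_rpow_of_exponent_le one_le_two
    (mul_le_mul_of_nonneg_right hγ (Nat.cast_nonneg _))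

lemma exists_divergesAtRate_of_lt_divExponent {c : Idx N d → ℝ} {x : E d} {Γ : ℝ}
    (h : (Γ : EReal) < divExponent ψ c x) : ∃ n : ℕ, DivergesAtRate ψ c (Γ + 1 / (n + 1)) x := by
  obtain ⟨γ, hγ⟩ := lt_iSup_iff.1 h
  obtain ⟨hdiv, hγ⟩ := lt_iSup_iff.1 hγ
  obtain ⟨n, hn⟩ := exists_nat_one_div_lt (sub_pos.2 (EReal.coe_lt_coe_iff.1 hγ))
  exact ⟨n, hdiv.mono (by linarith)⟩

/-- Near every point of the unit cube, some of the numbers `y` attached to large wavelets are not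
exponentially small, in every window of scales of a fixed length. -/
def HasLargeCoeffs (ψ : Fin N → E d → 𝕜) (T : Fin L → Idx N d) (C₀ : ℝ) (y : Idx N d → ℝ) : Prop :=
  ∀ n : ℕ, ∃ W : ℕ, ∀ᶠ m : ℕ in atTop, ∀ x ∈ unitCube d, ∃ i < W, ∃ l : Fin L,
    C₀ ≤ ‖wavelet ψ (subIdx T l (m + i) (cubePos ((m + i) * depth T) x)) x‖ ∧
    (2 : ℝ) ^ (-(1 / (n + 1 : ℝ)) * ((m + i : ℕ) : ℝ)) ≤
      |y (subIdx T l (m + i) (cubePos ((m + i) * depth T) x))|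

lemma ae_hasLargeCoeffs {Ω : Type*} [MeasurableSpace Ω] {P : Measure Ω} [IsProbabilityMeasure P]
    {ξ : Idx N d → Ω → ℝ} (hpos : ∀ l, 0 < (T l).2.1) (hξi : iIndepFun ξ P)
    (hξu : ∀ a, pdf.IsUniform (ξ a) (Set.Icc (-1) 1) P volume) {C₀ : ℝ}
    (h : ∀ x ∈ unitCube d, ∃ l, C₀ ≤ ‖wavelet ψ (T l) x‖) :
    ∀ᵐ ω ∂P, HasLargeCoeffs ψ T C₀ fun a => ξ a ω := by
  choose W hW using fun n : ℕ => ae_eventually_exists_large (ε := 1 / (n + 1 : ℝ)) hpos hξi hξu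
    (by positivity)
  filter_upwards [ae_all_iff.2 hW] with ω hω n
  refine ⟨W n, ?_⟩
  filter_upwards [hω n] with m hm x hx
  choose σ hσ using exists_le_norm_wavelet_subIdx h x
  obtain ⟨i, hi⟩ := hm (cubePos ((m + W n) * depth T) x) (cubePos_mem_boxPos hx _)
    fun i => σ (m + i)
  rw [ancestorPos_cubePos i.2] at hi
  exact ⟨i, i.2, σ (m + i), hσ _, hi⟩

lemma divergesAtRate_of_irredScale_le (hM : 0 < depth T) {s : ℝ} {p : ℝ≥0∞} {C₀ : ℝ} (hC₀ : 0 < C₀)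
    {y : Idx N d → ℝ} (hy : HasLargeCoeffs ψ T C₀ y) {x : E d} (hx : x ∈ unitCube d) {θ : ℝ}
    (hθ : ∀ W : ℕ, ∃ C : ℝ, ∃ᶠ m : ℕ in atTop, ∀ i < W,
      (irredScale ((m + i) * depth T) (cubePos ((m + i) * depth T) x) : ℝ) ≤
        θ * ((m + i) * depth T : ℕ) + C)
    {γ : ℝ} (hγ : γ < dOver d p * (1 - θ) - s) :
    DivergesAtRate ψ (fun a => y a * fCoeff T s p a.2.1 a.2.2) γ x := by
  set D := dOver d p with hD
  have hD0 : 0 ≤ D := dOver_nonneg d p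
  obtain ⟨n, hn⟩ := exists_nat_one_div_lt (half_pos (sub_pos.2 hγ))
  set ε := 1 / (n + 1 : ℝ) with hε
  have hε0 : 0 < ε := by positivity
  obtain ⟨W, hW⟩ := hy n
  obtain ⟨C, hC⟩ := hθ W
  obtain ⟨C₁, hC₁⟩ := sq_log_le hε0
  have key : ∀ m₀ : ℕ, ∃ a : Idx N d, m₀ ≤ a.2.1 ∧
      C₀ * (2 : ℝ) ^ (-(C₁ + D * C + |γ| * depth T)) * (2 : ℝ) ^ (γ * (a.2.1 : ℝ)) ≤
        ‖(y a * fCoeff T s p a.2.1 a.2.2) • wavelet ψ a x‖ := fun m₀ => by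
    obtain ⟨m, hJ, hm, hm₀⟩ := (hC.and_eventually (hW.and (eventually_ge_atTop (m₀ + 1)))).exists
    obtain ⟨i, hi, l, hψ, hyl⟩ := hm x hx
    specialize hJ i hi
    have hbox := cubePos_mem_boxPos hx ((m + i) * depth T)
    set κ := cubePos ((m + i) * depth T) x
    have hf := eCoeff_le_fCoeff hM s p (by omega : 1 ≤ m + i) hbox l
    refine ⟨subIdx T l (m + i) κ, ?_, ?_⟩
    · change m₀ ≤ (m + i) * depth T + (T l).2.1
      nlinarith
    rw [norm_smul, Real.norm_eq_abs, abs_mul, abs_of_nonneg (fCoeff_nonneg _ _ _ _ _)]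
    have hj : ((subIdx T l (m + i) κ).2.1 : ℝ) = ((m + i) * depth T : ℕ) + ((T l).2.1 : ℝ) := by
      simp [subIdx]
    have hmu : ((m + i : ℕ) : ℝ) ≤ ((m + i) * depth T : ℕ) := by
      exact_mod_cast Nat.le_mul_of_pos_right _ hM
    have hlM : ((T l).2.1 : ℝ) ≤ depth T := by exact_mod_cast le_depth T l
    have hlog := hC₁ ((m + i) * depth T)
    set u : ℕ := (m + i) * depth T
    have hu0 : (0 : ℝ) ≤ u := Nat.cast_nonneg u
    calc C₀ * (2 : ℝ) ^ (-(C₁ + D * C + |γ| * depth T)) *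
          (2 : ℝ) ^ (γ * ((subIdx T l (m + i) κ).2.1 : ℝ))
        ≤ (2 : ℝ) ^ (-ε * ((m + i : ℕ) : ℝ)) * eCoeff s p u κ * C₀ := by
          rw [eCoeff_eq, mul_assoc, ← Real.rpow_add two_pos, ← Real.rpow_add two_pos, mul_comm]
          refine mul_le_mul_of_nonneg_right (Real.rpow_le_rpow_of_exponent_le one_le_two ?_) hC₀.le
          rw [hj]
          have h1 : γ * ((T l).2.1 : ℝ) ≤ |γ| * depth T :=
            mul_le_mul (le_abs_self γ) hlM (Nat.cast_nonneg _) (abs_nonneg _)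
          have h2 : D * (irredScale u κ : ℝ) ≤ D * (θ * u + C) := mul_le_mul_of_nonneg_left hJ hD0
          have h3 : ε * ((m + i : ℕ) : ℝ) ≤ ε * u := mul_le_mul_of_nonneg_left hmu hε0.le
          have h4 : 2 * ε * u ≤ (D * (1 - θ) - s - γ) * u :=
            mul_le_mul_of_nonneg_right (by linarith) hu0
          rw [← hD]
          linarith
      _ ≤ _ := by
          refine mul_le_mul (mul_le_mul hyl hf (eCoeff_pos _ _ _ _).le (abs_nonneg _)) hψ hC₀.le ?_
          exact mul_nonneg (abs_nonneg _) (fCoeff_nonneg _ _ _ _ _)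
  choose a ha hb using key
  exact ⟨_, by positivity, a, tendsto_atTop_mono ha tendsto_id, hb⟩

lemma neg_le_divExponent (hM : 0 < depth T) {s : ℝ} {p : ℝ≥0∞} {C₀ : ℝ} (hC₀ : 0 < C₀)
    {y : Idx N d → ℝ} (hy : HasLargeCoeffs ψ T C₀ y) {x : E d} (hx : x ∈ unitCube d) :
    ((-s : ℝ) : EReal) ≤ divExponent ψ (fun a => y a * fCoeff T s p a.2.1 a.2.2) x := by
  refine le_divExponent fun γ hγ => divergesAtRate_of_irredScale_le hM hC₀ hy hx (θ := 1)
    (fun W => ⟨0, Eventually.frequently (Eventually.of_forall fun m i _ => ?_)⟩) (by linarith)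
  rw [one_mul, add_zero]
  exact_mod_cast (irredScale_mem _ _).1

end Rate

/-! ### Upper bounds for the divergence exponent -/

/-- A limsup of families of balls has Hausdorff measure zero if the corresponding series
converges. -/
lemma hausdorffMeasure_eq_zero_of_frequently {X : Type*} [MetricSpace X] [MeasurableSpace X]
    [BorelSpace X] {t : ℝ} (ht : 0 < t) {ι : ℕ → Type*} [∀ m, Fintype (ι m)] (z : ∀ m, ι m → X)
    {r : ℕ → ℝ} (hr : Antitone r) (hr0 : Tendsto r atTop (𝓝 0))
    (hsum : ∑' m, (Fintype.card (ι m) : ℝ≥0∞) * ENNReal.ofReal (2 * r m) ^ t ≠ ⊤) {G : Set X}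
    (hG : ∀ x ∈ G, ∀ m₀, ∃ m ≥ m₀, ∃ q, x ∈ Metric.closedBall (z m q) (r m)) :
    μH[t] G = 0 := by
  have hdiam : ∀ m q, Metric.ediam (Metric.closedBall (z m q) (r m)) ≤ ENNReal.ofReal (2 * r m) := by
    intro m q
    refine Metric.ediam_le_of_forall_dist_le fun x hx y hy => ?_
    have := dist_triangle_right x y (z m q)
    rw [Metric.mem_closedBall] at hx hy
    linarith
  have h := Measure.hausdorffMeasure_le_liminf_tsum t G (l := atTop)
    (ι := fun n : ℕ => Σ i : ℕ, ι (i + n)) (fun n => ENNReal.ofReal (2 * r n))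
    (by simpa using ENNReal.tendsto_ofReal (hr0.const_mul 2))
    (fun n q => Metric.closedBall (z (q.1 + n) q.2) (r (q.1 + n)))
    (Eventually.of_forall fun n q => (hdiam _ _).trans (ENNReal.ofReal_le_ofReal
      (mul_le_mul_of_nonneg_left (hr (Nat.le_add_left _ _)) zero_le_two)))
    (Eventually.of_forall fun n x hx => by
      obtain ⟨m, hm, q, hq⟩ := hG x hx n
      obtain ⟨i, rfl⟩ := Nat.exists_eq_add_of_le' hm
      exact mem_iUnion.2 ⟨⟨i, q⟩, hq⟩)
  refine le_antisymm (h.trans ?_) zero_le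
  have h0 := ENNReal.tendsto_sum_nat_add _ hsum
  rw [← h0.liminf_eq]
  refine liminf_le_liminf (Eventually.of_forall fun n => ?_)
  rw [ENNReal.tsum_sigma']
  refine ENNReal.tsum_le_tsum fun i => ?_
  rw [tsum_fintype]
  calc _ ≤ ∑ _q : ι (i + n), ENNReal.ofReal (2 * r (i + n)) ^ t :=
        Finset.sum_le_sum fun q _ => ENNReal.rpow_le_rpow (hdiam _ _) ht.le
    _ = _ := by rw [Finset.sum_const, Finset.card_univ, nsmul_eq_mul]

lemma norm_le_of_forall_abs_le {d : ℕ} {y : E d} {b : ℝ} (hb : 0 ≤ b) (h : ∀ t, |y t| ≤ b) :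
    ‖y‖ ≤ d * b := by
  rw [EuclideanSpace.norm_eq]
  refine Real.sqrt_le_iff.2 ⟨by positivity, ?_⟩
  calc ∑ t, ‖y t‖ ^ 2 ≤ ∑ _t : Fin d, b ^ 2 :=
        Finset.sum_le_sum fun t _ => pow_le_pow_left₀ (norm_nonneg _) (h t) 2
    _ = d * b ^ 2 := by simp
    _ ≤ (d * b) ^ 2 := by
        rw [mul_pow]
        refine mul_le_mul_of_nonneg_right ?_ (by positivity)
        have : d ≤ d ^ 2 := Nat.le_self_pow two_ne_zero d
        exact_mod_cast this

section Upper

variable {𝕜 : Type*} [RCLike 𝕜] {N d L : ℕ} {ψ : Fin N → E d → 𝕜} {T : Fin L → Idx N d}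

lemma DivergesAtRate.exists_boxPos (hψ : IsWaveletGenerator ψ) (hM : 0 < depth T) {s : ℝ}
    {p : ℝ≥0∞} {c : Idx N d → ℝ} (hc : ∀ a, |c a| ≤ fCoeff T s p a.2.1 a.2.2) {γ : ℝ} {x : E d}
    (h : DivergesAtRate ψ c γ x) {n : ℕ} (hn : 1 ≤ n) :
    ∃ C : ℝ, ∀ m₀ : ℕ, ∃ m ≥ m₀, ∃ κ ∈ boxPos d (m * depth T),
      dOver d p * (irredScale (m * depth T) κ : ℝ) ≤
        (dOver d p - s - γ) * (m * depth T : ℕ) + C ∧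
      ∀ t, |(2 : ℝ) ^ (m * depth T) * x t - κ t| ≤
        (2 : ℝ) ^ (((dOver d p - s - γ) * (m * depth T : ℕ) + C) / n) + C := by
  set D := dOver d p with hD
  have hD0 : 0 ≤ D := dOver_nonneg d p
  choose B hB using fun i => hψ i n
  set B₁ := ∑ i, |B i| + 1 with hB₁
  have hB₁0 : 0 < B₁ := by positivity
  have hBψ : ∀ i z, ‖ψ i z‖ ≤ B₁ / (1 + ‖z‖) ^ n := fun i z => by
    refine (hB i z).trans (div_le_div_of_nonneg_right ?_ (by positivity))
    have := Finset.single_le_sum (f := fun i => |B i|) (fun i _ => abs_nonneg _) (Finset.mem_univ i)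
    have h2 := le_abs_self (B i)
    linarith
  obtain ⟨C₀, hC₀, a, ha, hb⟩ := h
  set C' := B₁ * (2 : ℝ) ^ (|γ| * depth T) / C₀ with hC'
  have hC'0 : 0 < C' := by positivity
  set K : ℝ := ∑ l, ∑ t, |((T l).2.2 t : ℝ)| with hK
  have hKle : ∀ l t, |((T l).2.2 t : ℝ)| ≤ K := fun l t =>
    (Finset.single_le_sum (f := fun t => |((T l).2.2 t : ℝ)|) (fun _ _ => abs_nonneg _)
      (Finset.mem_univ t)).trans
    (Finset.single_le_sum (f := fun l => ∑ t, |((T l).2.2 t : ℝ)|)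
      (fun _ _ => Finset.sum_nonneg fun _ _ => abs_nonneg _) (Finset.mem_univ l))
  have hK0 : 0 ≤ K := Finset.sum_nonneg fun _ _ => Finset.sum_nonneg fun _ _ => abs_nonneg _
  refine ⟨|Real.logb 2 C'| + K, fun m₀ => ?_⟩
  obtain ⟨i, hi⟩ := (ha.eventually (eventually_ge_atTop ((m₀ + 1) * depth T))).exists
  specialize hb i
  obtain ⟨⟨i₀, j, k⟩, hai⟩ : ∃ b, b = a i := ⟨_, rfl⟩
  rw [← hai] at hi hb
  change (m₀ + 1) * depth T ≤ j at hi
  have hcpos : 0 < ‖c (i₀, j, k) • wavelet ψ (i₀, j, k) x‖ := 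
    (mul_pos hC₀ (Real.rpow_pos_of_pos two_pos _)).trans_le hb
  have hf0 : fCoeff T s p j k ≠ 0 := fun h0 => by
    have := hc (i₀, j, k)
    simp only [h0] at this
    rw [abs_nonpos_iff.1 this, zero_smul, norm_zero] at hcpos
    exact hcpos.false
  obtain ⟨m, κ, l, hm, hκ, hj, hk, hf⟩ := exists_of_fCoeff_ne_zero hM hf0
  have hl := le_depth T l
  have hm₀ : m₀ ≤ m := by
    by_contra hlt
    have : (m + 1) * depth T ≤ m₀ * depth T := Nat.mul_le_mul_right _ (by omega)
    rw [Nat.succ_mul] at this hi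
    omega
  set u := m * depth T with hu
  set z : E d := WithLp.toLp 2 fun t => (2 : ℝ) ^ j * x t - (k t : ℝ) with hz
  set η := D - s - γ with hη
  set J : ℝ := (irredScale u κ : ℝ) with hJ
  have hA : 1 ≤ (1 + ‖z‖) ^ n := one_le_pow₀ (by linarith [norm_nonneg z])
  have hR : 1 ≤ (2 : ℝ) ^ (D * J) := Real.one_le_rpow one_le_two (by positivity)
  have hlM : ((T l).2.1 : ℝ) ≤ depth T := by exact_mod_cast hl
  have hjR : (j : ℝ) = u + ((T l).2.1 : ℝ) := by rw [hj]; push_cast; rfl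
  have hmain : (1 + ‖z‖) ^ n * (2 : ℝ) ^ (D * J) ≤ (2 : ℝ) ^ (η * u + Real.logb 2 C') := by
    have h1 : C₀ * (2 : ℝ) ^ (γ * u - |γ| * depth T) ≤
        (2 : ℝ) ^ ((D - s) * u - D * J) * (B₁ / (1 + ‖z‖) ^ n) := by
      calc C₀ * (2 : ℝ) ^ (γ * u - |γ| * depth T) ≤ C₀ * (2 : ℝ) ^ (γ * (j : ℝ)) := by
            refine mul_le_mul_of_nonneg_left
              (Real.rpow_le_rpow_of_exponent_le one_le_two ?_) hC₀.le
            rw [hjR]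
            have : -γ * ((T l).2.1 : ℝ) ≤ |γ| * depth T :=
              mul_le_mul (neg_le_abs γ) hlM (Nat.cast_nonneg _) (abs_nonneg _)
            linarith
        _ ≤ ‖c (i₀, j, k) • wavelet ψ (i₀, j, k) x‖ := hb
        _ ≤ _ := by
            rw [norm_smul, Real.norm_eq_abs]
            refine mul_le_mul ((hc _).trans ?_) (hBψ i₀ z) (norm_nonneg _) (by positivity)
            simp only
            rw [hf]
            exact eCoeff_le s p u κ
    have e1 : (2 : ℝ) ^ (γ * u - |γ| * depth T) =
        (2 : ℝ) ^ (γ * u) / (2 : ℝ) ^ (|γ| * depth T) := Real.rpow_sub two_pos _ _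
    have e2 : (2 : ℝ) ^ (η * u) =
        (2 : ℝ) ^ ((D - s) * u - D * J) * (2 : ℝ) ^ (D * J) / (2 : ℝ) ^ (γ * u) := by
      rw [← Real.rpow_add two_pos, ← Real.rpow_sub two_pos]; congr 1; rw [hη]; ring
    rw [Real.rpow_add two_pos, Real.rpow_logb two_pos (by norm_num) hC'0, e2, hC']
    rw [e1, mul_div_assoc', mul_div_assoc',
      div_le_div_iff₀ (by positivity) (by positivity)] at h1
    rw [div_mul_div_comm, le_div_iff₀ (by positivity)]
    have h2 := mul_le_mul_of_nonneg_right h1 (by positivity : 0 ≤ (2 : ℝ) ^ (D * J))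
    linarith
  have hmain1 : (2 : ℝ) ^ (D * J) ≤ (2 : ℝ) ^ (η * u + Real.logb 2 C') :=
    (le_mul_of_one_le_left (by positivity) hA).trans hmain
  have hmain2 : (1 + ‖z‖) ^ n ≤ (2 : ℝ) ^ (η * u + Real.logb 2 C') :=
    (le_mul_of_one_le_right (by positivity) hR).trans hmain
  have hn0 : (0 : ℝ) < n := by exact_mod_cast hn
  have hlog := le_abs_self (Real.logb 2 C')
  refine ⟨m, hm₀, κ, hκ, ?_, fun t => ?_⟩
  · have := (Real.rpow_le_rpow_left_iff one_lt_two).1 hmain1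
    linarith
  · have h1 : 1 + ‖z‖ ≤ (2 : ℝ) ^ ((η * u + (|Real.logb 2 C'| + K)) / n) := by
      refine le_of_pow_le_pow_left₀ (by omega : n ≠ 0) (by positivity) (hmain2.trans ?_)
      rw [← Real.rpow_natCast, ← Real.rpow_mul two_pos.le, div_mul_cancel₀ _ hn0.ne']
      exact Real.rpow_le_rpow_of_exponent_le one_le_two (by linarith)
    have h2 : |(2 : ℝ) ^ j * x t - (k t : ℝ)| ≤ ‖z‖ := by
      have := PiLp.norm_apply_le z t
      rwa [Real.norm_eq_abs] at this
    have h3 : (2 : ℝ) ^ (T l).2.1 * ((2 : ℝ) ^ u * x t - κ t) =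
        ((2 : ℝ) ^ j * x t - (k t : ℝ)) + ((T l).2.2 t : ℝ) := by
      rw [hk t, hj]; push_cast; rw [pow_add]; ring
    calc |(2 : ℝ) ^ u * x t - κ t| ≤ (2 : ℝ) ^ (T l).2.1 * |(2 : ℝ) ^ u * x t - κ t| :=
          le_mul_of_one_le_left (abs_nonneg _) (one_le_pow₀ one_le_two)
      _ = |((2 : ℝ) ^ j * x t - (k t : ℝ)) + ((T l).2.2 t : ℝ)| := by
          rw [← h3, abs_mul, abs_of_pos (by positivity : (0 : ℝ) < (2 : ℝ) ^ (T l).2.1)]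
      _ ≤ |(2 : ℝ) ^ j * x t - (k t : ℝ)| + |((T l).2.2 t : ℝ)| := abs_add_le _ _
      _ ≤ _ := by linarith [hKle l t, abs_nonneg (Real.logb 2 C')]

lemma not_divergesAtRate_of_gt (hψ : IsWaveletGenerator ψ) (hM : 0 < depth T) {s : ℝ}
    {p : ℝ≥0∞} {c : Idx N d → ℝ} (hc : ∀ a, |c a| ≤ fCoeff T s p a.2.1 a.2.2) {γ : ℝ}
    (hγ : dOver d p - s < γ) (x : E d) : ¬ DivergesAtRate ψ c γ x := by
  intro h
  obtain ⟨C, hC⟩ := h.exists_boxPos hψ hM hc le_rfl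
  obtain ⟨m₀, hm₀⟩ := exists_nat_gt (C / (γ - (dOver d p - s)))
  rw [div_lt_iff₀ (by linarith)] at hm₀
  obtain ⟨m, hm, κ, -, h1, -⟩ := hC m₀
  have h2 : 0 ≤ dOver d p * (irredScale (m * depth T) κ : ℝ) :=
    mul_nonneg (dOver_nonneg d p) (Nat.cast_nonneg _)
  have h3 : (m₀ : ℝ) ≤ (m * depth T : ℕ) := by
    exact_mod_cast hm.trans (Nat.le_mul_of_pos_right _ hM)
  nlinarith

/-- The set of divergence at rate `γ` has dimension at most `d (d/p - s - γ) / (d/p)`. -/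
lemma hausdorffMeasure_divergesAtRate_eq_zero (hψ : IsWaveletGenerator ψ) (hM : 0 < depth T) {s : ℝ}
    {p : ℝ≥0∞} {c : Idx N d → ℝ} (hc : ∀ a, |c a| ≤ fCoeff T s p a.2.1 a.2.2) {γ t : ℝ}
    (ht : 0 < t) (htγ : d * (dOver d p - s - γ) < dOver d p * t) :
    μH[t] {x | DivergesAtRate ψ c γ x} = 0 := by
  set D := dOver d p with hD
  set η := D - s - γ with hη
  have hD0 : 0 ≤ D := dOver_nonneg d p
  rcases lt_or_ge η 0 with hη0 | hη0
  · have : {x | DivergesAtRate ψ c γ x} = ∅ := eq_empty_of_forall_notMem fun x =>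
      not_divergesAtRate_of_gt hψ hM hc (by linarith) x
    rw [this, measure_empty]
  have hDpos : 0 < D := by
    refine lt_of_le_of_ne hD0 fun h0 => ?_
    rw [← h0, zero_mul] at htγ
    exact absurd htγ (not_lt.2 (by positivity))
  have hδ : 0 < t - d * η / D := by
    rw [sub_pos, div_lt_iff₀ hDpos]; linarith
  obtain ⟨n, hn⟩ := exists_nat_gt (η * t / (t - d * η / D))
  have hn0 : (0 : ℝ) < n := lt_of_le_of_lt (by positivity) hn
  have hn1 : 1 ≤ n := by exact_mod_cast hn0
  rw [div_lt_iff₀ hδ, ← div_lt_iff₀' hn0] at hn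
  have hηn : η / n < 1 := by
    have h1 : 0 ≤ d * η / D := by positivity
    have h2 : η / n * t < 1 * t := by
      rw [div_mul_eq_mul_div]; linarith
    exact lt_of_mul_lt_mul_right h2 ht.le
  have hMR : (0 : ℝ) < depth T := by exact_mod_cast hM
  let G : ℕ → Set (E d) := fun C => {x | ∀ m₀ : ℕ, ∃ m ≥ m₀, ∃ κ ∈ boxPos d (m * depth T),
      D * (irredScale (m * depth T) κ : ℝ) ≤ η * (m * depth T : ℕ) + C ∧
      ∀ i, |(2 : ℝ) ^ (m * depth T) * x i - κ i| ≤
        (2 : ℝ) ^ ((η * (m * depth T : ℕ) + C) / n) + C}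
  have hsub : {x | DivergesAtRate ψ c γ x} ⊆ ⋃ C, G C := fun x hx => by
    obtain ⟨C, hC⟩ := DivergesAtRate.exists_boxPos hψ hM hc hx hn1
    obtain ⟨C', hC'⟩ := exists_nat_ge C
    refine mem_iUnion.2 ⟨C', fun m₀ => ?_⟩
    obtain ⟨m, hm, κ, hκ, h1, h2⟩ := hC m₀
    refine ⟨m, hm, κ, hκ, h1.trans (by linarith), fun i => (h2 i).trans (add_le_add ?_ hC')⟩
    refine Real.rpow_le_rpow_of_exponent_le one_le_two (div_le_div_of_nonneg_right ?_ hn0.le)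
    linarith
  refine measure_mono_null hsub (measure_iUnion_null fun C => ?_)
  set R : ℕ → ℕ := fun m => ⌊(η * (m * depth T : ℕ) + C) / D⌋₊ with hR
  set A : ℝ := d * ((2 : ℝ) ^ ((C : ℝ) / n) + C) with hA
  have hA0 : 0 ≤ A := by positivity
  set σ : ℝ := (2 : ℝ) ^ ((η / n - 1) * depth T) with hσ
  have hσ0 : 0 < σ := by positivity
  have hσ1 : σ < 1 := Real.rpow_lt_one_of_one_lt_of_neg one_lt_two (by nlinarith)
  have hσm : ∀ m : ℕ, σ ^ m = (2 : ℝ) ^ ((η / n - 1) * (m * depth T : ℕ)) := fun m => by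
    rw [hσ, ← Real.rpow_natCast, ← Real.rpow_mul two_pos.le]; congr 1; push_cast; ring
  refine hausdorffMeasure_eq_zero_of_frequently ht (ι := fun m => boxPos d (R m))
    (fun m q => WithLp.toLp 2 fun i => (q.1 i : ℝ) / 2 ^ R m) (r := fun m => A * σ ^ m)
    ?_ ?_ ?_ ?_
  · exact fun m m' h => mul_le_mul_of_nonneg_left (pow_le_pow_of_le_one hσ0.le hσ1.le h) hA0
  · simpa using (tendsto_pow_atTop_nhds_zero_of_lt_one hσ0.le hσ1).const_mul A
  · set τ : ℝ := (2 : ℝ) ^ ((d * η / D + (η / n - 1) * t) * depth T) with hτ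
    have hτ0 : 0 < τ := by positivity
    have hτ1 : τ < 1 := by
      refine Real.rpow_lt_one_of_one_lt_of_neg one_lt_two (mul_neg_of_neg_of_pos ?_ hMR)
      have : η / n * t = η * t / n := by ring
      linarith
    have hs : Summable fun m : ℕ => (2 : ℝ) ^ (d * C / D) * (2 * A) ^ t * τ ^ m :=
      (summable_geometric_of_lt_one hτ0.le hτ1).mul_left _
    refine ne_top_of_le_ne_top hs.tsum_ofReal_ne_top (ENNReal.tsum_le_tsum fun m => ?_)
    rw [Fintype.card_coe, card_boxPos, ENNReal.ofReal_rpow_of_nonneg (by positivity) ht.le,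
      ← ENNReal.ofReal_natCast, ← ENNReal.ofReal_mul (by positivity)]
    refine ENNReal.ofReal_le_ofReal ?_
    have h1 : ((2 ^ (d * R m) : ℕ) : ℝ) ≤ (2 : ℝ) ^ (d * ((η * (m * depth T : ℕ) + C) / D)) := by
      push_cast
      rw [← Real.rpow_natCast]
      refine Real.rpow_le_rpow_of_exponent_le one_le_two ?_
      push_cast
      refine mul_le_mul_of_nonneg_left ?_ (Nat.cast_nonneg _)
      have := Nat.floor_le (by positivity : 0 ≤ (η * (m * depth T : ℕ) + C) / D)
      exact_mod_cast this
    refine (mul_le_mul_of_nonneg_right h1 (by positivity)).trans (le_of_eq ?_)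
    rw [← mul_assoc 2 A, Real.mul_rpow (by positivity) (by positivity), hσm,
      ← Real.rpow_mul two_pos.le, hτ, ← Real.rpow_natCast _ m, ← Real.rpow_mul two_pos.le,
      mul_left_comm, ← Real.rpow_add two_pos, mul_comm ((2 : ℝ) ^ (d * C / D)),
      mul_assoc ((2 * A) ^ t), ← Real.rpow_add two_pos]
    congr 2
    push_cast
    ring
  · intro x hx m₀
    obtain ⟨m, hm, κ, hκ, h1, h2⟩ := hx m₀
    have hJ : irredScale (m * depth T) κ ≤ R m := by
      refine Nat.le_floor ?_
      rw [le_div_iff₀ hDpos]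
      linarith
    obtain ⟨k', hk', hkk⟩ := exists_boxPos_of_irredScale_le hκ hJ
    refine ⟨m, hm, ⟨k', hk'⟩, ?_⟩
    rw [Metric.mem_closedBall, dist_eq_norm]
    rw [hA, mul_assoc]
    refine norm_le_of_forall_abs_le (by positivity) fun i => ?_
    simp only [PiLp.sub_apply]
    rw [← hkk i, hσm]
    have hu : (0 : ℝ) < (2 : ℝ) ^ (m * depth T) := by positivity
    have e1 : x i - (κ i : ℝ) / 2 ^ (m * depth T) =
        ((2 : ℝ) ^ (m * depth T) * x i - κ i) / 2 ^ (m * depth T) := by field_simp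
    have e2 : (2 : ℝ) ^ ((η / n - 1) * (m * depth T : ℕ)) =
        (2 : ℝ) ^ (η * (m * depth T : ℕ) / n) / 2 ^ (m * depth T) := by
      rw [← Real.rpow_natCast 2 (m * depth T), ← Real.rpow_sub two_pos]
      congr 1; ring
    have e3 : 1 ≤ (2 : ℝ) ^ (η * (m * depth T : ℕ) / n) :=
      Real.one_le_rpow one_le_two (by positivity)
    rw [e1, abs_div, abs_of_pos hu, e2, mul_div_assoc']
    refine div_le_div_of_nonneg_right ((h2 i).trans ?_) hu.le
    rw [add_div, Real.rpow_add two_pos, add_mul, mul_comm]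
    gcongr
    exact le_mul_of_one_le_right (Nat.cast_nonneg _) e3

end Upper

/-! ### A strictly increasing sequence with long gaps -/

open Classical in
/-- The largest factorial which is at most `i`. -/
def floorFactorial (i : ℕ) : ℕ := Nat.findGreatest (fun c => ∃ n : ℕ, c = n.factorial) i

open Classical in
lemma floorFactorial_le (i : ℕ) : floorFactorial i ≤ i := Nat.findGreatest_le i

open Classical in
lemma floorFactorial_mono : Monotone floorFactorial := fun _ _ h => Nat.findGreatest_mono_right _ h

open Classical in
lemma factorial_le_floorFactorial {n i : ℕ} (h : n.factorial ≤ i) :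
    n.factorial ≤ floorFactorial i := Nat.le_findGreatest h ⟨n, rfl⟩

open Classical in
lemma floorFactorial_le_factorial {n i : ℕ} (h : i < (n + 1).factorial) :
    floorFactorial i ≤ n.factorial := by
  by_cases h0 : floorFactorial i = 0
  · rw [h0]; exact Nat.zero_le _
  obtain ⟨k, hk⟩ := Nat.findGreatest_of_ne_zero (rfl : floorFactorial i = floorFactorial i) h0
  rw [hk]
  have h1 : k.factorial < (n + 1).factorial := by
    rw [← hk]; exact (floorFactorial_le i).trans_lt h
  exact Nat.factorial_le (Nat.lt_succ_iff.1 (lt_of_not_ge fun h2 =>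
    absurd (Nat.factorial_le h2) (not_le.2 h1)))

/-- A sequence of density `1 / α`, with gaps `[J, α' J]` for all `α' < α`. -/
def gapSeq (α : ℝ) (i : ℕ) : ℕ := i + ⌊(α - 1) * floorFactorial i⌋₊

lemma gapSeq_strictMono {α : ℝ} (hα : 1 ≤ α) : StrictMono (gapSeq α) := fun i j h => by
  refine add_lt_add_of_lt_of_le h (Nat.floor_le_floor ?_)
  have : (floorFactorial i : ℝ) ≤ floorFactorial j := by exact_mod_cast floorFactorial_mono h.le
  exact mul_le_mul_of_nonneg_left this (by linarith)

lemma gapSeq_le {α : ℝ} (hα : 1 ≤ α) (i : ℕ) : (gapSeq α i : ℝ) ≤ α * i := by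
  have h0 : 0 ≤ α - 1 := by linarith
  have h1 : (⌊(α - 1) * floorFactorial i⌋₊ : ℝ) ≤ (α - 1) * floorFactorial i :=
    Nat.floor_le (by positivity)
  have h2 : (floorFactorial i : ℝ) ≤ i := by exact_mod_cast floorFactorial_le i
  have h3 := mul_le_mul_of_nonneg_left h2 h0
  unfold gapSeq
  push_cast
  linarith

lemma exists_gap {α α' : ℝ} (h1 : 1 < α') (h2 : α' < α) (J₀ : ℕ) :
    ∃ J ≥ J₀, ∃ j : ℕ, J ≤ j ∧ α' * J ≤ j ∧ ∀ i, gapSeq α i < J ∨ j < gapSeq α i := by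
  obtain ⟨n, hn⟩ := exists_nat_ge (max (J₀ : ℝ) ((α' * (α - 1) + 2) / (α - α')))
  have hnJ : J₀ ≤ n := by exact_mod_cast (le_max_left _ _).trans hn
  have hn2 := (le_max_right _ _).trans hn
  rw [div_le_iff₀ (by linarith)] at hn2
  set J := (n + 1).factorial + ⌊(α - 1) * n.factorial⌋₊ with hJ
  have hJle : (J : ℝ) ≤ (n + 1).factorial + (α - 1) * n.factorial := by
    have : (⌊(α - 1) * n.factorial⌋₊ : ℝ) ≤ (α - 1) * n.factorial :=
      Nat.floor_le (mul_nonneg (by linarith) (Nat.cast_nonneg _))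
    rw [hJ]; push_cast; linarith
  have hJ0 : (0 : ℝ) ≤ J := Nat.cast_nonneg _
  refine ⟨J, ?_, ⌈α' * J⌉₊, ?_, Nat.le_ceil _, fun i => ?_⟩
  · exact hnJ.trans ((Nat.le_succ n).trans ((Nat.self_le_factorial _).trans (Nat.le_add_right _ _)))
  · have : (J : ℝ) ≤ (⌈α' * J⌉₊ : ℝ) := le_trans (by nlinarith) (Nat.le_ceil _)
    exact_mod_cast this
  rcases lt_or_ge i (n + 1).factorial with hi | hi
  · left
    refine add_lt_add_of_lt_of_le hi (Nat.floor_le_floor ?_)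
    have : (floorFactorial i : ℝ) ≤ n.factorial := by
      exact_mod_cast floorFactorial_le_factorial hi
    exact mul_le_mul_of_nonneg_left this (by linarith)
  · right
    have h3 : (⌈α' * J⌉₊ : ℝ) < α' * J + 1 := Nat.ceil_lt_add_one (by positivity)
    have h4 : ((n + 1).factorial : ℝ) ≤ floorFactorial i := by
      exact_mod_cast factorial_le_floorFactorial hi
    have h5 : ((n + 1).factorial : ℝ) ≤ i := by exact_mod_cast hi
    have h6 : (α - 1) * floorFactorial i < (⌊(α - 1) * floorFactorial i⌋₊ : ℝ) + 1 :=
      Nat.lt_floor_add_one _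
    have h7 : (α - 1) * ((n + 1).factorial : ℝ) ≤ (α - 1) * floorFactorial i :=
      mul_le_mul_of_nonneg_left h4 (by linarith)
    have h8 : ((n + 1).factorial : ℝ) = (n + 1) * n.factorial := by
      rw [Nat.factorial_succ]; push_cast; rfl
    have h9 : (1 : ℝ) ≤ n.factorial := by exact_mod_cast Nat.factorial_pos n
    have h10 : α' * J ≤ α' * ((n + 1).factorial + (α - 1) * n.factorial) :=
      mul_le_mul_of_nonneg_left hJle (by linarith)
    have h11 : 2 * (n.factorial : ℝ) ≤
        (α - α') * ((n + 1) * n.factorial) - α' * ((α - 1) * n.factorial) := by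
      have h12 : 2 ≤ (α - α') * (n + 1) - α' * (α - 1) := by nlinarith
      have := mul_le_mul_of_nonneg_right h12 (by linarith : (0 : ℝ) ≤ n.factorial)
      linarith
    have h13 : (⌈α' * J⌉₊ : ℝ) < (gapSeq α i : ℝ) := by
      unfold gapSeq
      push_cast
      rw [h8] at h5 h7 h10
      linarith
    exact_mod_cast h13

/-! ### Binary expansions with prescribed positions of the digits -/

/-- The sum of the series `∑ D_i 2^{-(a_i + 1)}`. -/
def binSum (a : ℕ → ℕ) (D : ℕ → ℤ) : ℝ := ∑' i, (D i : ℝ) * ((2 : ℝ) ^ (a i + 1))⁻¹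

section BinSum

variable {a : ℕ → ℕ} {D : ℕ → ℤ}

lemma norm_binSum_term_le (ha : StrictMono a) (hD : ∀ i, |D i| ≤ 1) (n i : ℕ) :
    ‖(D (i + n) : ℝ) * ((2 : ℝ) ^ (a (i + n) + 1))⁻¹‖ ≤ ((2 : ℝ) ^ a n)⁻¹ / 2 / 2 ^ i := by
  have h1 : |(D (i + n) : ℝ)| ≤ 1 := by exact_mod_cast hD (i + n)
  have h2 : a n + 1 + i ≤ a (i + n) + 1 := by
    have := ha.add_le_nat i n
    omega
  rw [norm_mul, Real.norm_eq_abs, Real.norm_of_nonneg (by positivity)]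
  have h3 : ((2 : ℝ) ^ (a (i + n) + 1))⁻¹ ≤ ((2 : ℝ) ^ (a n + 1 + i))⁻¹ :=
    inv_anti₀ (by positivity) (pow_le_pow_right₀ one_le_two h2)
  calc _ ≤ 1 * ((2 : ℝ) ^ (a n + 1 + i))⁻¹ := mul_le_mul h1 h3 (by positivity) zero_le_one
    _ = _ := by rw [pow_add, pow_add, one_mul]; field_simp

lemma summable_binSum (ha : StrictMono a) (hD : ∀ i, |D i| ≤ 1) :
    Summable fun i => (D i : ℝ) * ((2 : ℝ) ^ (a i + 1))⁻¹ :=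
  Summable.of_norm_bounded (hasSum_geometric_two' _).summable (norm_binSum_term_le ha hD 0)

lemma binSum_eq_sum_add (ha : StrictMono a) (hD : ∀ i, |D i| ≤ 1) (n : ℕ) :
    binSum a D = ∑ i ∈ Finset.range n, (D i : ℝ) * ((2 : ℝ) ^ (a i + 1))⁻¹ +
      ∑' i, (D (i + n) : ℝ) * ((2 : ℝ) ^ (a (i + n) + 1))⁻¹ :=
  ((summable_binSum ha hD).sum_add_tsum_nat_add n).symm

lemma abs_binSum_tail_le (ha : StrictMono a) (hD : ∀ i, |D i| ≤ 1) (n : ℕ) :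
    |∑' i, (D (i + n) : ℝ) * ((2 : ℝ) ^ (a (i + n) + 1))⁻¹| ≤ ((2 : ℝ) ^ a n)⁻¹ :=
  tsum_of_norm_bounded (hasSum_geometric_two' _) (norm_binSum_term_le ha hD n)

/-- The integers `∑_{i ≤ n} D_i 2^{n - i}`. -/
def prefixInt (D : ℕ → ℤ) : ℕ → ℤ
  | 0 => D 0
  | n + 1 => 2 * prefixInt D n + D (n + 1)

lemma sum_eq_prefixInt (D : ℕ → ℤ) (n : ℕ) :
    ∑ i ∈ Finset.range (n + 1), (D i : ℝ) * ((2 : ℝ) ^ (id i + 1))⁻¹ =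
      prefixInt D n / 2 ^ (n + 1) := by
  induction n with
  | zero => simp [prefixInt]; ring
  | succ n ih =>
    rw [Finset.sum_range_succ, ih, prefixInt]
    push_cast
    simp only [id]
    rw [pow_succ _ (n + 1)]
    field_simp

lemma prefixInt_le_sum (ha : StrictMono a) (hD : ∀ i, |D i| ≤ 1) (n : ℕ) :
    (prefixInt D n = 0 ∧
      ∑ i ∈ Finset.range (n + 1), (D i : ℝ) * ((2 : ℝ) ^ (a i + 1))⁻¹ = 0) ∨
    (1 ≤ prefixInt D n ∧ (prefixInt D n : ℝ) ≤ 2 ^ (a n + 1) *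
      ∑ i ∈ Finset.range (n + 1), (D i : ℝ) * ((2 : ℝ) ^ (a i + 1))⁻¹) ∨
    (prefixInt D n ≤ -1 ∧ 2 ^ (a n + 1) *
      ∑ i ∈ Finset.range (n + 1), (D i : ℝ) * ((2 : ℝ) ^ (a i + 1))⁻¹ ≤ (prefixInt D n : ℝ)) := by
  induction n with
  | zero =>
    have e : (2 : ℝ) ^ (a 0 + 1) *
        ∑ i ∈ Finset.range (0 + 1), (D i : ℝ) * ((2 : ℝ) ^ (a i + 1))⁻¹ = D 0 := by
      rw [zero_add, Finset.sum_range_one]; field_simp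
    have h := abs_le.1 (hD 0)
    rcases lt_trichotomy (D 0) 0 with h0 | h0 | h0
    · exact Or.inr (Or.inr ⟨by simp only [prefixInt]; omega, by rw [e, prefixInt]⟩)
    · exact Or.inl ⟨h0, by simp [h0]⟩
    · exact Or.inr (Or.inl ⟨by simp only [prefixInt]; omega, by rw [e, prefixInt]⟩)
  | succ n ih =>
    set S := ∑ i ∈ Finset.range (n + 1), (D i : ℝ) * ((2 : ℝ) ^ (a i + 1))⁻¹ with hS
    have hsum : ∑ i ∈ Finset.range (n + 1 + 1), (D i : ℝ) * ((2 : ℝ) ^ (a i + 1))⁻¹ =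
        S + (D (n + 1) : ℝ) * ((2 : ℝ) ^ (a (n + 1) + 1))⁻¹ := Finset.sum_range_succ _ _
    have e : (2 : ℝ) ^ (a (n + 1) + 1) * (S + (D (n + 1) : ℝ) * ((2 : ℝ) ^ (a (n + 1) + 1))⁻¹) =
        2 ^ (a (n + 1) - a n) * (2 ^ (a n + 1) * S) + D (n + 1) := by
      have hpow : (2 : ℝ) ^ (a (n + 1) + 1) = 2 ^ (a (n + 1) - a n) * 2 ^ (a n + 1) := by
        rw [← pow_add]; congr 1
        have := ha (Nat.lt_succ_self n)
        simp only [Nat.succ_eq_add_one] at this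
        omega
      rw [mul_add, mul_left_comm _ (D (n + 1) : ℝ), mul_inv_cancel₀ (by positivity), hpow]
      ring
    have h2 : (2 : ℝ) ≤ 2 ^ (a (n + 1) - a n) := by
      have := ha (Nat.lt_succ_self n)
      simp only [Nat.succ_eq_add_one] at this
      exact le_self_pow₀ one_le_two (by omega)
    have h := abs_le.1 (hD (n + 1))
    rw [hsum, e]
    rcases ih with ⟨h0, hS0⟩ | ⟨h1, hP⟩ | ⟨h1, hP⟩
    · simp only [prefixInt, h0, hS0, mul_zero, zero_add]
      rcases lt_trichotomy (D (n + 1)) 0 with h0 | h0 | h0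
      · exact Or.inr (Or.inr ⟨by omega, le_rfl⟩)
      · exact Or.inl ⟨h0, by simp [h0]⟩
      · exact Or.inr (Or.inl ⟨by omega, le_rfl⟩)
    · refine Or.inr (Or.inl ⟨by simp only [prefixInt]; omega, ?_⟩)
      simp only [prefixInt]
      push_cast
      have h3 : (1 : ℝ) ≤ prefixInt D n := by exact_mod_cast h1
      have h4 : 2 * (2 ^ (a n + 1) * S) ≤ 2 ^ (a (n + 1) - a n) * (2 ^ (a n + 1) * S) :=
        mul_le_mul_of_nonneg_right h2 (by linarith)
      linarith
    · refine Or.inr (Or.inr ⟨by simp only [prefixInt]; omega, ?_⟩)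
      simp only [prefixInt]
      push_cast
      have h3 : (prefixInt D n : ℝ) ≤ -1 := by exact_mod_cast h1
      have h4 : 2 ^ (a (n + 1) - a n) * (2 ^ (a n + 1) * S) ≤ 2 * (2 ^ (a n + 1) * S) :=
        mul_le_mul_of_nonpos_right h2 (by linarith)
      linarith

lemma abs_binSum_id_le (hD : ∀ i, |D i| ≤ 1) {n : ℕ} (hP : |prefixInt D n| ≤ 1) :
    |binSum id D| ≤ 2 * ((2 : ℝ) ^ (n + 1))⁻¹ := by
  rw [binSum_eq_sum_add strictMono_id hD (n + 1), sum_eq_prefixInt]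
  have h1 := abs_binSum_tail_le strictMono_id hD (n + 1)
  have h2 : |(prefixInt D n : ℝ)| ≤ 1 := by exact_mod_cast hP
  have h3 : |(prefixInt D n : ℝ) / 2 ^ (n + 1)| ≤ ((2 : ℝ) ^ (n + 1))⁻¹ := by
    rw [abs_div, abs_of_pos (by positivity : (0 : ℝ) < 2 ^ (n + 1)), div_eq_mul_inv]
    exact mul_le_of_le_one_left (by positivity) h2
  refine (abs_add_le _ _).trans ?_
  simp only [id] at h1 ⊢
  linarith

/-- Moving the binary digits from the positions `a_i ≤ α i` to the positions `i` is a Hölder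
continuous operation. -/
lemma abs_binSum_id_le_rpow (ha : StrictMono a) (hD : ∀ i, |D i| ≤ 1) {α : ℝ} (hα : 1 ≤ α)
    (haα : ∀ i, (a i : ℝ) ≤ α * i) : |binSum id D| ≤ 4 * |binSum a D| ^ α⁻¹ := by
  have hα0 : 0 < α := by linarith
  by_cases hex : ∃ n, 2 ≤ |prefixInt D n|
  · classical
    have hn := Nat.find_spec hex
    have hmin := fun m => Nat.find_min (m := m) hex
    set n := Nat.find hex with hnd
    have hn0 : n ≠ 0 := fun h0 => by
      rw [h0] at hn
      have := hD 0
      simp only [prefixInt] at hn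
      omega
    obtain ⟨k, hk⟩ := Nat.exists_eq_succ_of_ne_zero hn0
    have hkP : |prefixInt D k| ≤ 1 := by
      have := hmin k (by omega)
      omega
    have hY := abs_binSum_id_le hD hkP
    set S := ∑ i ∈ Finset.range (n + 1), (D i : ℝ) * ((2 : ℝ) ^ (a i + 1))⁻¹ with hS
    have hSn : 2 ≤ 2 ^ (a n + 1) * |S| := by
      have hpos : (0 : ℝ) < 2 ^ (a n + 1) := by positivity
      have hnR : (2 : ℝ) ≤ |(prefixInt D n : ℝ)| := by exact_mod_cast hn
      rw [← abs_of_pos hpos, ← abs_mul]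
      refine hnR.trans ?_
      rcases prefixInt_le_sum ha hD n with ⟨h0, -⟩ | ⟨h1, hP⟩ | ⟨h1, hP⟩
      · rw [h0] at hn; simp at hn
      · have h3 : (1 : ℝ) ≤ prefixInt D n := by exact_mod_cast h1
        exact abs_le_abs_of_nonneg (by linarith) hP
      · have h3 : (prefixInt D n : ℝ) ≤ -1 := by exact_mod_cast h1
        exact abs_le_abs_of_nonpos (by linarith) hP
    have hX : ((2 : ℝ) ^ (a n + 1))⁻¹ ≤ |binSum a D| := by
      rw [binSum_eq_sum_add ha hD (n + 1)]
      have h1 := abs_binSum_tail_le ha hD (n + 1)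
      have h2 : ((2 : ℝ) ^ a (n + 1))⁻¹ ≤ ((2 : ℝ) ^ (a n + 1))⁻¹ :=
        inv_anti₀ (by positivity) (pow_le_pow_right₀ one_le_two (ha (Nat.lt_succ_self n)))
      have h3 : 2 * ((2 : ℝ) ^ (a n + 1))⁻¹ ≤ |S| := by
        rw [← div_eq_mul_inv, div_le_iff₀' (by positivity)]; exact hSn
      have h4 := abs_sub_abs_le_abs_add S
        (∑' i, (D (i + (n + 1)) : ℝ) * ((2 : ℝ) ^ (a (i + (n + 1)) + 1))⁻¹)
      linarith
    have hX' : ((2 : ℝ) ^ (n + 1))⁻¹ ≤ |binSum a D| ^ α⁻¹ := by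
      refine le_trans ?_ (Real.rpow_le_rpow (by positivity) hX (by positivity))
      rw [← Real.rpow_natCast, ← Real.rpow_natCast, ← Real.rpow_neg two_pos.le,
        ← Real.rpow_neg two_pos.le, ← Real.rpow_mul two_pos.le]
      refine Real.rpow_le_rpow_of_exponent_le one_le_two ?_
      push_cast
      rw [neg_mul, neg_le_neg_iff, ← div_eq_mul_inv, div_le_iff₀ hα0]
      nlinarith [haα n]
    have hk' : ((2 : ℝ) ^ (k + 1))⁻¹ = 2 * ((2 : ℝ) ^ (n + 1))⁻¹ := by
      rw [hk, Nat.succ_eq_add_one, pow_succ _ (k + 1)]; field_simp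
    rw [hk'] at hY
    linarith
  · push Not at hex
    have h0 : |binSum id D| ≤ 0 := by
      have hlim : Tendsto (fun n : ℕ => 2 * ((2 : ℝ) ^ (n + 1))⁻¹) atTop (𝓝 0) := by
        have h := (tendsto_pow_atTop_nhds_zero_of_lt_one (r := (2 : ℝ)⁻¹) (by norm_num)
          (by norm_num)).comp (tendsto_add_atTop_nat 1)
        simpa [Function.comp_def, inv_pow] using h.const_mul 2
      exact ge_of_tendsto' hlim fun n => abs_binSum_id_le hD (Int.lt_add_one_iff.1 (hex n))
    exact h0.trans (by positivity)

lemma binSum_sub (ha : StrictMono a) {D' : ℕ → ℤ} (hD : ∀ i, |D i| ≤ 1) (hD' : ∀ i, |D' i| ≤ 1) :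
    binSum a (fun i => D i - D' i) = binSum a D - binSum a D' := by
  unfold binSum
  rw [← (summable_binSum ha hD).tsum_sub (summable_binSum ha hD')]
  congr 1 with i
  push_cast
  ring

/-- A gap in the positions of the digits gives good dyadic approximations. -/
lemma exists_int_approx_of_gap (ha : StrictMono a) (hD : ∀ i, D i = 0 ∨ D i = 1) {J j : ℕ}
    (hgap : ∀ i, a i < J ∨ j < a i) :
    ∃ k : ℤ, (k : ℝ) ≤ 2 ^ J * binSum a D ∧ 2 ^ j * (2 ^ J * binSum a D - k) < 2 ^ J := by
  classical
  have hD1 : ∀ i, |D i| ≤ 1 := fun i => by rcases hD i with h | h <;> simp [h]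
  have hex : ∃ i, J ≤ a i := ⟨J, ha.id_le J⟩
  set n := Nat.find hex
  have hn := Nat.find_spec hex
  have hjn : j + 1 ≤ a n := (hgap n).resolve_left (not_lt.2 hn)
  rw [binSum_eq_sum_add ha hD1 n]
  set R := ∑' i, (D (i + n) : ℝ) * ((2 : ℝ) ^ (a (i + n) + 1))⁻¹ with hR
  have hR0 : 0 ≤ R := tsum_nonneg fun i => by
    rcases hD (i + n) with h | h <;> rw [h] <;> simp
  have hR1 : R ≤ ((2 : ℝ) ^ (j + 1))⁻¹ := (le_abs_self _).trans ((abs_binSum_tail_le ha hD1 n).trans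
    (inv_anti₀ (by positivity) (pow_le_pow_right₀ one_le_two hjn)))
  have hS : (2 : ℝ) ^ J * ∑ i ∈ Finset.range n, (D i : ℝ) * ((2 : ℝ) ^ (a i + 1))⁻¹ =
      ((∑ i ∈ Finset.range n, D i * 2 ^ (J - (a i + 1)) : ℤ) : ℝ) := by
    push_cast
    rw [Finset.mul_sum]
    refine Finset.sum_congr rfl fun i hi => ?_
    have hi' : a i + 1 ≤ J := not_le.1 (Nat.find_min hex (Finset.mem_range.1 hi))
    rw [mul_left_comm, pow_sub₀ (2 : ℝ) two_ne_zero hi']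
  refine ⟨∑ i ∈ Finset.range n, D i * 2 ^ (J - (a i + 1)), ?_, ?_⟩
  · rw [mul_add, hS]
    have : 0 ≤ (2 : ℝ) ^ J * R := by positivity
    linarith
  · rw [mul_add, hS, add_sub_cancel_left, mul_left_comm]
    refine mul_lt_of_lt_one_right (by positivity) ?_
    calc (2 : ℝ) ^ j * R ≤ 2 ^ j * ((2 : ℝ) ^ (j + 1))⁻¹ := by gcongr
      _ = 1 / 2 := by rw [pow_succ]; field_simp
      _ < 1 := by norm_num

lemma binSum_mem_Icc (ha : StrictMono a) (hD : ∀ i, D i = 0 ∨ D i = 1) :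
    binSum a D ∈ Set.Icc (0 : ℝ) 1 := by
  have hD1 : ∀ i, |D i| ≤ 1 := fun i => by rcases hD i with h | h <;> simp [h]
  refine ⟨tsum_nonneg fun i => by rcases hD i with h | h <;> rw [h] <;> simp, ?_⟩
  have h := (le_abs_self _).trans (abs_binSum_tail_le ha hD1 0)
  exact h.trans (inv_le_one_of_one_le₀ (one_le_pow₀ one_le_two))

end BinSum

lemma exists_binSum_id_eq {y : ℝ} (hy : y ∈ Set.Ico (0 : ℝ) 1) :
    ∃ b : ℕ → Fin 2, binSum id (fun i => (b i : ℤ)) = y := by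
  refine ⟨Real.digits y 2, ?_⟩
  have h := (Real.hasSum_ofDigitsTerm_digits y one_lt_two hy).tsum_eq
  refine Eq.trans ?_ h
  unfold binSum Real.ofDigitsTerm
  congr 1 with i

/-- Transport of Hausdorff measures by a Hölder continuous change of parametrization. -/
lemma hausdorffMeasure_image_le_of_edist_le {ι X Y : Type*} [EMetricSpace X] [EMetricSpace Y]
    [MeasurableSpace X] [BorelSpace X] [MeasurableSpace Y] [BorelSpace Y] [Nonempty Y]
    {f : ι → X} {g : ι → Y}
    {C r : NNReal} (hr : 0 < r) (h : ∀ a b, edist (g a) (g b) ≤ C * edist (f a) (f b) ^ (r : ℝ))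
    {t : ℝ} (ht : 0 ≤ t) (s : Set ι) : μH[t] (g '' s) ≤ (C : ℝ≥0∞) ^ t * μH[r * t] (f '' s) := by
  classical
  let F : X → Y := fun x => if hx : ∃ a, f a = x then g hx.choose else Classical.arbitrary Y
  have hF : ∀ a, F (f a) = g a := fun a => by
    have hx : ∃ b, f b = f a := ⟨a, rfl⟩
    have h1 := h hx.choose a
    rw [hx.choose_spec, edist_self, ENNReal.zero_rpow_of_pos (by exact_mod_cast hr), mul_zero] at h1
    simp only [F, dif_pos hx]
    exact edist_le_zero.1 h1
  have hH : HolderOnWith C r F (f '' s) := by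
    rintro _ ⟨a, -, rfl⟩ _ ⟨b, -, rfl⟩
    rw [hF, hF]
    exact h a b
  have himg : g '' s = F '' (f '' s) := by
    rw [image_image]
    exact image_congr fun a _ => (hF a).symm
  rw [himg]
  exact hH.hausdorffMeasure_image_le hr ht

/-! ### Cantor sets of points that are well approximated by dyadic points -/

lemma irredScale_cubePos_le {d : ℕ} {x : E d} {J j u : ℕ} (hu : u ≤ j)
    (hk : ∀ t, ∃ k : ℤ, (k : ℝ) ≤ 2 ^ J * x t ∧ 2 ^ j * (2 ^ J * x t - k) < 2 ^ J) :
    irredScale u (cubePos u x) ≤ J := by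
  rcases le_or_gt u J with huJ | huJ
  · exact (irredScale_mem _ _).1.trans huJ
  refine irredScale_le huJ.le fun t => ?_
  obtain ⟨k, hk1, hk2⟩ := hk t
  refine ⟨k, Int.floor_eq_iff.2 ?_⟩
  have hu' : (2 : ℝ) ^ u = 2 ^ (u - J) * 2 ^ J := by rw [← pow_add, Nat.sub_add_cancel huJ.le]
  have h1 : (2 : ℝ) ^ u * (2 ^ J * x t - k) < 2 ^ J :=
    (mul_le_mul_of_nonneg_right (pow_le_pow_right₀ one_le_two hu) (by linarith)).trans_lt hk2
  have h2 : (2 : ℝ) ^ J * (2 ^ (u - J) * (2 ^ J * x t - k)) < 2 ^ J * 1 := by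
    rw [mul_one]
    refine lt_of_eq_of_lt ?_ h1
    rw [hu']; ring
  have h3 := lt_of_mul_lt_mul_left h2 (by positivity)
  have h4 := mul_le_mul_of_nonneg_left hk1 (by positivity : (0 : ℝ) ≤ 2 ^ (u - J))
  push_cast
  rw [hu']
  constructor <;> nlinarith

/-- The point of the cube of scale `j₀` and position `k₀` given by binary digits at the positions of
`gapSeq α`. -/
def cantorPoint {d : ℕ} (α : ℝ) (j₀ : ℕ) (k₀ : Fin d → ℤ) (b : Fin d → ℕ → Fin 2) : E d :=
  WithLp.toLp 2 fun t => (k₀ t + binSum (gapSeq α) fun i => (b t i : ℤ)) / 2 ^ j₀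

lemma fin_two_cast_eq (b : Fin 2) : (b : ℤ) = 0 ∨ (b : ℤ) = 1 := by
  fin_cases b <;> simp

lemma abs_fin_two_cast_le (b : Fin 2) : |(b : ℤ)| ≤ 1 := by
  fin_cases b <;> simp

lemma abs_fin_two_cast_sub_le (b b' : Fin 2) : |(b : ℤ) - (b' : ℤ)| ≤ 1 := by
  fin_cases b <;> fin_cases b' <;> simp

lemma exists_frequently_irredScale_cantorPoint_le {d : ℕ} {α θ : ℝ} (hθ : α⁻¹ < θ)
    (hα : 1 ≤ α) (hθ1 : θ < 1) (j₀ : ℕ) (k₀ : Fin d → ℤ) (b : Fin d → ℕ → Fin 2) {M : ℕ}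
    (hM : 0 < M) (W : ℕ) :
    ∃ C : ℝ, ∃ᶠ m : ℕ in atTop, ∀ i < W,
      (irredScale ((m + i) * M) (cubePos ((m + i) * M) (cantorPoint α j₀ k₀ b)) : ℝ) ≤
        θ * ((m + i) * M : ℕ) + C := by
  have hα0 : 0 < α := by linarith
  have hθ0 : 0 < θ := (inv_pos.2 hα0).trans hθ
  refine ⟨((W + 1) * M : ℕ) + j₀, frequently_atTop.2 fun m₀ => ?_⟩
  obtain ⟨J, hJ, j, hJj, hj, hgap⟩ := exists_gap ((one_lt_inv₀ hθ0).2 hθ1)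
    (inv_lt_of_inv_lt₀ hα0 hθ) ((m₀ + W) * M)
  have hdiv : m₀ + W ≤ j / M := (Nat.le_div_iff_mul_le hM).2 (hJ.trans hJj)
  refine ⟨j / M - W, by omega, fun i hi => ?_⟩
  set m := j / M - W with hm
  have hmW : m + W = j / M := by omega
  have hu : (m + i) * M ≤ j + j₀ := by
    refine (Nat.mul_le_mul_right M (by omega : m + i ≤ j / M)).trans ?_
    exact (Nat.div_mul_le_self _ _).trans (Nat.le_add_right _ _)
  have hirr : irredScale ((m + i) * M) (cubePos ((m + i) * M) (cantorPoint α j₀ k₀ b)) ≤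
      J + j₀ := by
    refine irredScale_cubePos_le hu fun t => ?_
    obtain ⟨k, hk1, hk2⟩ := exists_int_approx_of_gap (gapSeq_strictMono hα)
      (fun i => fin_two_cast_eq (b t i)) hgap
    set X := binSum (gapSeq α) fun i => (b t i : ℤ) with hX
    have e : (2 : ℝ) ^ (J + j₀) * cantorPoint α j₀ k₀ b t = 2 ^ J * k₀ t + 2 ^ J * X := by
      simp only [cantorPoint, ← hX]
      rw [pow_add]; field_simp
    refine ⟨2 ^ J * k₀ t + k, ?_, ?_⟩
    · rw [e]; push_cast; linarith
    · rw [e]; push_cast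
      have e2 : (2 : ℝ) ^ (j + j₀) * (2 ^ J * k₀ t + 2 ^ J * X - (2 ^ J * k₀ t + k)) =
          2 ^ j * (2 ^ J * X - k) * 2 ^ j₀ := by rw [pow_add]; ring
      rw [e2, pow_add]
      exact mul_lt_mul_of_pos_right hk2 (by positivity)
  have h1 : (irredScale ((m + i) * M) (cubePos ((m + i) * M) (cantorPoint α j₀ k₀ b)) : ℝ) ≤
      J + j₀ := by exact_mod_cast hirr
  have h2 : (J : ℝ) ≤ θ * j := by
    rw [inv_mul_le_iff₀ hθ0] at hj; exact hj
  have h3 : j ≤ (m + i) * M + (W + 1) * M := by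
    have h4 := Nat.lt_div_mul_add (a := j) hM
    have h5 : j / M * M ≤ (m + i + W) * M := Nat.mul_le_mul_right M (by omega)
    have h6 : (m + i) * M + (W + 1) * M = (m + i + W) * M + M := by ring
    omega
  have h3' : (j : ℝ) ≤ ((m + i) * M : ℕ) + ((W + 1) * M : ℕ) := by exact_mod_cast h3
  have h7 : θ * (((W + 1) * M : ℕ) : ℝ) ≤ ((W + 1) * M : ℕ) :=
    mul_le_of_le_one_left (Nat.cast_nonneg _) hθ1.le
  have h8 := mul_le_mul_of_nonneg_left h3' hθ0.le
  linarith

/-- An open set contains the closure of a dyadic cube. -/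
lemma exists_dyadic_subset {d : ℕ} {B : Set (E d)} (hB : IsOpen B) (hne : B.Nonempty) :
    ∃ (j₀ : ℕ) (k₀ : Fin d → ℤ), ∀ y : Fin d → ℝ, (∀ t, y t ∈ Set.Icc (0 : ℝ) 1) →
      (WithLp.toLp 2 fun t => (k₀ t + y t) / 2 ^ j₀ : E d) ∈ B := by
  obtain ⟨x, hx⟩ := hne
  obtain ⟨r, hr, hrB⟩ := Metric.isOpen_iff.1 hB x hx
  obtain ⟨j₀, hj₀⟩ := exists_pow_lt_of_lt_one (show 0 < r / (d + 1) by positivity)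
    (show (2 : ℝ)⁻¹ < 1 by norm_num)
  refine ⟨j₀, cubePos j₀ x, fun y hy => hrB ?_⟩
  rw [Metric.mem_ball, dist_eq_norm]
  have hpos : (0 : ℝ) < 2 ^ j₀ := by positivity
  refine (norm_le_of_forall_abs_le (b := ((2 : ℝ)⁻¹) ^ j₀) (by positivity) fun t => ?_).trans_lt ?_
  · simp only [PiLp.sub_apply]
    have e : (cubePos j₀ x t + y t) / 2 ^ j₀ - x t =
        (cubePos j₀ x t + y t - 2 ^ j₀ * x t) / 2 ^ j₀ := by field_simp
    rw [e, abs_div, abs_of_pos hpos, inv_pow, ← one_div]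
    refine div_le_div_of_nonneg_right ?_ hpos.le
    have h1 := Int.floor_le ((2 : ℝ) ^ j₀ * x t)
    have h2 := Int.lt_floor_add_one ((2 : ℝ) ^ j₀ * x t)
    have h3 := hy t
    rw [abs_le]
    simp only [cubePos]
    constructor <;> linarith [h3.1, h3.2]
  · rw [lt_div_iff₀ (by positivity)] at hj₀
    have : (0 : ℝ) ≤ (2 : ℝ)⁻¹ ^ j₀ := by positivity
    linarith

lemma dist_binSum_id_le {d : ℕ} {α : ℝ} (hα : 1 ≤ α) (j₀ : ℕ) (k₀ : Fin d → ℤ)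
    (b b' : Fin d → ℕ → Fin 2) :
    dist (fun t => binSum id fun i => (b t i : ℤ)) (fun t => binSum id fun i => (b' t i : ℤ)) ≤
      4 * ((2 : ℝ) ^ j₀) ^ α⁻¹ * dist (cantorPoint α j₀ k₀ b) (cantorPoint α j₀ k₀ b') ^ α⁻¹ := by
  have hα0 : 0 ≤ α⁻¹ := inv_nonneg.2 (by linarith)
  refine (dist_pi_le_iff (by positivity)).2 fun t => ?_
  have ha := gapSeq_strictMono hα
  rw [Real.dist_eq, ← binSum_sub strictMono_id (fun i => abs_fin_two_cast_le _)
    (fun i => abs_fin_two_cast_le _)]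
  refine (abs_binSum_id_le_rpow ha (fun i => abs_fin_two_cast_sub_le _ _) hα
    (gapSeq_le hα)).trans ?_
  rw [binSum_sub ha (fun i => abs_fin_two_cast_le _) (fun i => abs_fin_two_cast_le _), mul_assoc,
    ← Real.mul_rpow (by positivity) dist_nonneg]
  refine mul_le_mul_of_nonneg_left (Real.rpow_le_rpow (abs_nonneg _) ?_ hα0) (by norm_num)
  have h1 : |cantorPoint α j₀ k₀ b t - cantorPoint α j₀ k₀ b' t| ≤
      dist (cantorPoint α j₀ k₀ b) (cantorPoint α j₀ k₀ b') := by
    rw [dist_eq_norm]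
    have := PiLp.norm_apply_le (cantorPoint α j₀ k₀ b - cantorPoint α j₀ k₀ b') t
    rwa [Real.norm_eq_abs] at this
  refine le_trans (le_of_eq ?_) (mul_le_mul_of_nonneg_left h1 (by positivity))
  rw [← abs_of_pos (by positivity : (0 : ℝ) < 2 ^ j₀), ← abs_mul]
  congr 1
  simp only [cantorPoint]
  field_simp
  ring

/-- The Cantor sets are so large that removing a set of measure zero for the `d/α`-dimensional
Hausdorff measure leaves a set of dimension at least `d/α`. -/
lemma le_dimH_cantorPoint_diff {d : ℕ} {α : ℝ} (hα : 1 ≤ α) (j₀ : ℕ) (k₀ : Fin d → ℤ)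
    {Z : Set (E d)} (hZ : μH[α⁻¹ * d] Z = 0) :
    ENNReal.ofReal (α⁻¹ * d) ≤ dimH (range (cantorPoint α j₀ k₀) \ Z) := by
  have hα0 : 0 < α := by linarith
  let g : (Fin d → ℕ → Fin 2) → (Fin d → ℝ) := fun b t => binSum id fun i => (b t i : ℤ)
  set r : NNReal := ⟨α⁻¹, (inv_pos.2 hα0).le⟩ with hr
  have hr0 : 0 < r := inv_pos.2 hα0
  have hH : ∀ b b', edist (g b) (g b') ≤ (4 * ((2 : ℝ) ^ j₀) ^ α⁻¹).toNNReal *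
      edist (cantorPoint α j₀ k₀ b) (cantorPoint α j₀ k₀ b') ^ (r : ℝ) := fun b b' => by
    rw [edist_dist, edist_dist, ENNReal.ofReal_rpow_of_nonneg dist_nonneg r.coe_nonneg]
    change _ ≤ ENNReal.ofReal _ * _
    rw [← ENNReal.ofReal_mul (by positivity)]
    exact ENNReal.ofReal_le_ofReal (dist_binSum_id_le hα j₀ k₀ b b')
  have hvol : ∀ s : Set (Fin d → ℕ → Fin 2), μH[α⁻¹ * d] (cantorPoint α j₀ k₀ '' s) = 0 →
      volume (g '' s) = 0 := fun s hs => by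
    have h := hausdorffMeasure_image_le_of_edist_le hr0 hH (Nat.cast_nonneg d) s
    have hs' : μH[(r : ℝ) * (d : ℝ)] (cantorPoint α j₀ k₀ '' s) = 0 := hs
    rw [hs', mul_zero] at h
    have h2 := hausdorffMeasure_pi_real (ι := Fin d)
    rw [Fintype.card_fin] at h2
    rw [← h2]
    exact le_antisymm h zero_le
  have hcube : Set.univ.pi (fun _ : Fin d => Set.Ico (0 : ℝ) 1) ⊆ g '' univ := fun y hy => by
    choose b hb using fun t => exists_binSum_id_eq (hy t (mem_univ t))
    exact ⟨b, mem_univ _, funext hb⟩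
  set S := {b | cantorPoint α j₀ k₀ b ∈ Z} with hS
  have hne : μH[α⁻¹ * d] (cantorPoint α j₀ k₀ '' Sᶜ) ≠ 0 := fun h0 => by
    have h1 : volume (g '' S) = 0 := hvol S (measure_mono_null (image_subset_iff.2 fun b hb => hb) hZ)
    have h2 := measure_union_null h1 (hvol _ h0)
    rw [← image_union, union_compl_self] at h2
    have h3 := measure_mono_null hcube h2
    rw [volume_pi_pi] at h3
    simp at h3
  have hle := le_dimH_of_hausdorffMeasure_ne_zero (d := r * d) (by push_cast; exact hne)
  have e : ENNReal.ofReal (α⁻¹ * d) = ((r * d : NNReal) : ℝ≥0∞) := by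
    rw [ENNReal.ofReal_mul (inv_pos.2 hα0).le, ENNReal.ofReal_natCast, ENNReal.coe_mul]
    congr 1
    exact ENNReal.ofReal_eq_coe_nnreal (inv_pos.2 hα0).le
  rw [e]
  refine hle.trans (dimH_mono ?_)
  rintro _ ⟨b, hb, rfl⟩
  exact ⟨mem_range_self b, hb⟩

lemma volume_eq_zero_of_hausdorffMeasure {d : ℕ} {S : Set (E d)} (h : μH[(d : ℝ)] S = 0) :
    volume S = 0 := by
  have h1 : volume ((WithLp.ofLp : E d → Fin d → ℝ) '' S) = 0 := by
    have h2 := (PiLp.lipschitzWith_ofLp 2 fun _ : Fin d => ℝ).hausdorffMeasure_image_le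
      (Nat.cast_nonneg d) S
    rw [h, mul_zero] at h2
    have h3 := hausdorffMeasure_pi_real (ι := Fin d)
    rw [Fintype.card_fin] at h3
    rw [← h3]
    exact le_antisymm h2 zero_le
  exact measure_mono_null (subset_preimage_image _ _)
    ((PiLp.volume_preserving_ofLp (Fin d)).quasiMeasurePreserving.preimage_null h1)

/-! ### Maximal divergence -/

section Maximal

variable {𝕜 : Type*} [RCLike 𝕜] {N d L : ℕ} {ψ : Fin N → E d → 𝕜} {T : Fin L → Idx N d}

lemma le_dimH_divExponent_eq (hd : 0 < d) (hψ : IsWaveletGenerator ψ) (hM : 0 < depth T) {s : ℝ}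
    {p : ℝ≥0∞} {C₀ : ℝ} (hC₀ : 0 < C₀) {y : Idx N d → ℝ} (hy : HasLargeCoeffs ψ T C₀ y)
    (hc : ∀ a, |y a * fCoeff T s p a.2.1 a.2.2| ≤ fCoeff T s p a.2.1 a.2.2)
    {B : Set (E d)} (hB : IsOpen B) (hne : B.Nonempty) (hBA : B ⊆ unitCube d) {α : ℝ}
    (hα : 1 ≤ α) {γ : ℝ} (hγ : γ = dOver d p * (1 - α⁻¹) - s) :
    ENNReal.ofReal (α⁻¹ * d) ≤
      dimH {x | x ∈ B ∧ divExponent ψ (fun a => y a * fCoeff T s p a.2.1 a.2.2) x = (γ : EReal)} := by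
  have hα0 : 0 < α := by linarith
  set D := dOver d p with hD
  have hD0 : 0 ≤ D := dOver_nonneg d p
  have hdR : (0 : ℝ) < d := by exact_mod_cast hd
  set c : Idx N d → ℝ := fun a => y a * fCoeff T s p a.2.1 a.2.2 with hcdef
  obtain ⟨j₀, k₀, hjk⟩ := exists_dyadic_subset hB hne
  have hK : ∀ b, cantorPoint α j₀ k₀ b ∈ B := fun b => hjk _ fun t =>
    binSum_mem_Icc (gapSeq_strictMono hα) fun i => fin_two_cast_eq (b t i)
  set Z : Set (E d) := ⋃ n : ℕ, {x | DivergesAtRate ψ c (γ + 1 / (n + 1 : ℝ)) x} with hZ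
  have hZ0 : μH[α⁻¹ * d] Z = 0 := measure_iUnion_null fun n => by
    refine hausdorffMeasure_divergesAtRate_eq_zero hψ hM hc (by positivity) ?_
    rw [← hD]
    have h1 : D - s - (γ + 1 / (n + 1 : ℝ)) < D * α⁻¹ := by
      have : (0 : ℝ) < 1 / (n + 1 : ℝ) := by positivity
      rw [hγ]; linarith
    have h2 := mul_lt_mul_of_pos_left h1 hdR
    linarith
  refine (le_dimH_cantorPoint_diff hα j₀ k₀ hZ0).trans (dimH_mono ?_)
  rintro _ ⟨⟨b, rfl⟩, hb⟩
  refine ⟨hK b, le_antisymm ?_ ?_⟩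
  · by_contra hlt
    obtain ⟨n, hn⟩ := exists_divergesAtRate_of_lt_divExponent (not_le.1 hlt)
    exact hb (mem_iUnion.2 ⟨n, hn⟩)
  · rcases hα.eq_or_lt with h1 | h1
    · have : γ = -s := by rw [hγ, ← h1]; simp
      rw [this]
      exact neg_le_divExponent hM hC₀ hy (hBA (hK b))
    · refine le_divExponent fun γ' hγ' => ?_
      have hinv : α⁻¹ < 1 := inv_lt_one_of_one_lt₀ h1
      obtain ⟨θ, hθ1, hθ2, hθ3⟩ : ∃ θ, α⁻¹ < θ ∧ θ < 1 ∧ γ' < D * (1 - θ) - s := by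
        have hcont : Tendsto (fun θ : ℝ => D * (1 - θ) - s) (𝓝[>] α⁻¹) (𝓝 (D * (1 - α⁻¹) - s)) :=
          (Continuous.tendsto (by fun_prop) _).mono_left nhdsWithin_le_nhds
        rw [hγ] at hγ'
        obtain ⟨θ, h2, h3⟩ := ((hcont.eventually (lt_mem_nhds hγ')).and
          (Ioo_mem_nhdsGT hinv)).exists
        exact ⟨θ, h3.1, h3.2, h2⟩
      exact divergesAtRate_of_irredScale_le hM hC₀ hy (hBA (hK b))
        (exists_frequently_irredScale_cantorPoint_le hθ1 hα hθ2 j₀ k₀ b hM) hθ3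

lemma dimH_divExponent_eq_le (hd : 0 < d) (hψ : IsWaveletGenerator ψ) (hM : 0 < depth T) {s : ℝ}
    {p : ℝ≥0∞} (hp : 0 < p) (hp' : p ≠ ⊤) {c : Idx N d → ℝ}
    (hc : ∀ a, |c a| ≤ fCoeff T s p a.2.1 a.2.2) (γ : ℝ) :
    dimH {x | divExponent ψ c x = (γ : EReal)} ≤ ENNReal.ofReal (d - (s + γ) * p.toReal) := by
  have hdR : (0 : ℝ) < d := by exact_mod_cast hd
  have hr : 0 < p.toReal := ENNReal.toReal_pos hp.ne' hp'
  have hDr : dOver d p * p.toReal = d := by rw [dOver_eq]; field_simp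
  have hD0 : 0 < dOver d p := by rw [dOver_eq]; positivity
  set D := dOver d p
  refine le_of_forall_gt_imp_ge_of_dense fun t ht => ?_
  rcases eq_or_ne t ⊤ with rfl | htop
  · exact le_top
  lift t to NNReal using htop
  have ht' : d - (s + γ) * p.toReal < t := by
    by_contra hle
    rw [not_lt] at hle
    refine absurd ht (not_lt.2 ?_)
    rw [← ENNReal.ofReal_coe_nnreal]
    exact ENNReal.ofReal_le_ofReal hle
  have ht0 : (0 : ℝ) < t := by exact_mod_cast zero_le.trans_lt ht
  have h1 : d * (D - s - γ) < D * t := by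
    have h2 := mul_lt_mul_of_pos_left ht' hD0
    have h3 : D * (d - (s + γ) * p.toReal) = d * (D - s - γ) := by
      calc D * (d - (s + γ) * p.toReal) = D * d - (s + γ) * (D * p.toReal) := by ring
        _ = _ := by rw [hDr]; ring
    linarith
  obtain ⟨γ', hγ', h2⟩ : ∃ γ' < γ, d * (D - s - γ') < D * t := by
    refine ⟨γ - (D * t - d * (D - s - γ)) / (2 * d), ?_, ?_⟩
    · have : 0 < (D * t - d * (D - s - γ)) / (2 * d) := div_pos (by linarith) (by linarith)
      linarith
    · have : (d : ℝ) * ((D * t - d * (D - s - γ)) / (2 * d)) = (D * t - d * (D - s - γ)) / 2 := by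
        field_simp
      have e : (d : ℝ) * (D - s - (γ - (D * t - d * (D - s - γ)) / (2 * d))) =
        d * (D - s - γ) + d * ((D * t - d * (D - s - γ)) / (2 * d)) := by ring
      rw [e, this]
      linarith
  have h0 := hausdorffMeasure_divergesAtRate_eq_zero hψ hM hc ht0 h2
  refine (dimH_mono ?_).trans (dimH_le_of_hausdorffMeasure_ne_top (h0.trans_ne ENNReal.zero_ne_top))
  intro x hx
  have hlt : (γ' : EReal) < divExponent ψ c x := by
    rw [show divExponent ψ c x = (γ : EReal) from hx]
    exact EReal.coe_lt_coe_iff.2 hγ'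
  obtain ⟨n, hn⟩ := exists_divergesAtRate_of_lt_divExponent hlt
  exact hn.mono (by have : (0 : ℝ) < 1 / (n + 1 : ℝ) := by positivity
                    linarith)

lemma maximallyDivergent_of_hasLargeCoeffs (hd : 0 < d) (hψ : IsWaveletGenerator ψ)
    (hM : 0 < depth T) {s : ℝ} {p : ℝ≥0∞} (hp : 0 < p) {C₀ : ℝ} (hC₀ : 0 < C₀) {y : Idx N d → ℝ}
    (hy : HasLargeCoeffs ψ T C₀ y) (hy1 : ∀ a, y a ∈ Set.Icc (-1 : ℝ) 1) :
    MaximallyDivergent ψ s p (fun a => y a * fCoeff T s p a.2.1 a.2.2) (unitCube d) := by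
  have hdR : (0 : ℝ) < d := by exact_mod_cast hd
  have hc : ∀ a, |y a * fCoeff T s p a.2.1 a.2.2| ≤ fCoeff T s p a.2.1 a.2.2 := fun a => by
    rw [abs_mul, abs_of_nonneg (fCoeff_nonneg T s p _ _)]
    exact mul_le_of_le_one_left (fCoeff_nonneg T s p _ _) (abs_le.2 (hy1 a))
  refine ⟨fun x hx => ⟨neg_le_divExponent hM hC₀ hy hx,
    divExponent_le fun γ hγ => not_divergesAtRate_of_gt hψ hM hc hγ x⟩, ?_, ?_⟩
  · have hnull : volume (⋃ n : ℕ, {x | DivergesAtRate ψ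
        (fun a => y a * fCoeff T s p a.2.1 a.2.2) (-s + 1 / (n + 1 : ℝ)) x}) = 0 := by
      refine volume_eq_zero_of_hausdorffMeasure (measure_iUnion_null fun n => ?_)
      refine hausdorffMeasure_divergesAtRate_eq_zero hψ hM hc hdR ?_
      have : (0 : ℝ) < 1 / (n + 1 : ℝ) := by positivity
      nlinarith
    filter_upwards [measure_eq_zero_iff_ae_notMem.1 hnull] with x hx hxA
    refine le_antisymm ?_ (neg_le_divExponent hM hC₀ hy hxA)
    by_contra hlt
    obtain ⟨n, hn⟩ := exists_divergesAtRate_of_lt_divExponent (not_le.1 hlt)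
    exact hx (mem_iUnion.2 ⟨n, hn⟩)
  · intro B hB hne hBA γ hγ
    have hlow := fun α hα hγα => le_dimH_divExponent_eq (γ := γ) hd hψ hM hC₀ hy hc hB hne hBA
      (α := α) hα hγα
    rcases eq_or_ne p ⊤ with rfl | hp'
    · rw [dOver_top] at hγ
      have hγs : γ = -s := le_antisymm (by linarith [hγ.2]) hγ.1
      have h1 := hlow 1 le_rfl (by rw [hγs]; simp)
      rw [inv_one, one_mul, ENNReal.ofReal_natCast] at h1
      have e : ENNReal.ofReal (s + γ) = 0 := by rw [hγs]; simp
      rw [e, zero_mul, tsub_zero]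
      refine le_antisymm ((dimH_mono (subset_univ _)).trans (le_of_eq ?_)) h1
      rw [Real.dimH_univ_eq_finrank, finrank_euclideanSpace, Fintype.card_fin]
    · have hr : 0 < p.toReal := ENNReal.toReal_pos hp.ne' hp'
      have hDr : dOver d p * p.toReal = d := by rw [dOver_eq]; field_simp
      have hD0 : 0 < dOver d p := by rw [dOver_eq]; positivity
      have hsγ : 0 ≤ s + γ := by linarith [hγ.1]
      have e : (d : ℝ≥0∞) - ENNReal.ofReal (s + γ) * p =
          ENNReal.ofReal (d - (s + γ) * p.toReal) := by
        rw [ENNReal.ofReal_sub _ (by positivity), ENNReal.ofReal_mul hsγ, ENNReal.ofReal_toReal hp',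
          ENNReal.ofReal_natCast]
      rw [e]
      refine le_antisymm ((dimH_mono fun x hx => hx.2).trans
        (dimH_divExponent_eq_le hd hψ hM hp hp' hc γ)) ?_
      rcases hγ.2.eq_or_lt with hγ2 | hγ2
      · have : d - (s + γ) * p.toReal = 0 := by
          rw [hγ2, ← hDr]; ring
        rw [this, ENNReal.ofReal_zero]
        exact zero_le
      · have hq1 : 0 < 1 - (s + γ) / dOver d p := by
          rw [sub_pos, div_lt_one hD0]; linarith
        have hq2 : 1 - (s + γ) / dOver d p ≤ 1 := by
          have : 0 ≤ (s + γ) / dOver d p := by positivity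
          linarith
        have h1 := hlow (1 - (s + γ) / dOver d p)⁻¹ (one_le_inv_iff₀.2 ⟨hq1, hq2⟩)
          (by rw [inv_inv]; field_simp; ring)
        rw [inv_inv] at h1
        refine le_trans (le_of_eq ?_) h1
        congr 1
        rw [← hDr]
        field_simp

end Maximal

end SaturatingWavelets

end

open SaturatingWavelets in
theorem theorem1 {𝕜 : Type*} [RCLike 𝕜] {N d L : ℕ} (hd : 0 < d)
    (ψ : Fin N → E d → 𝕜) (hψ : IsWaveletGenerator ψ)
    (T : Fin L → Idx N d) (hT : IsDyadicCovering ψ T)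
    (s : ℝ) (p q : ℝ≥0∞) (hp : 0 < p) (hq : 0 < q)
    {Ω : Type*} [MeasurableSpace Ω] (P : Measure Ω) [IsProbabilityMeasure P]
    (ξ : Idx N d → Ω → ℝ) (hξm : ∀ a, Measurable (ξ a)) (hξi : iIndepFun ξ P)
    (hξu : ∀ a, pdf.IsUniform (ξ a) (Set.Icc (-1) 1) P volume) :
    (∃ K : Set (Besov N d s p q), IsCompact K ∧
      (∀ ω, (∀ a, ξ a ω ∈ Set.Icc (-1 : ℝ) 1) → satSeq T s p ξ ω ∈ Subtype.val '' K) ∧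
      ∀ᵐ ω ∂P, satSeq T s p ξ ω ∈ Subtype.val '' K) ∧
    ∀ᵐ ω ∂P, MaximallyDivergent ψ s p (satSeq T s p ξ ω) (unitCube d) := by
  have hM := hT.depth_pos
  obtain ⟨hpos, C₀, hC₀, hcov⟩ := hT
  have hbd : ∀ᵐ ω ∂P, ∀ a, ξ a ω ∈ Set.Icc (-1 : ℝ) 1 :=
    ae_all_iff.2 fun a => ae_mem_Icc_of_isUniform (hξu a)
  obtain ⟨K, hK, hmem⟩ := exists_isCompact_dominated (T := T) hM hpos s hp hq
  have hin : ∀ ω, (∀ a, ξ a ω ∈ Set.Icc (-1 : ℝ) 1) → satSeq T s p ξ ω ∈ Subtype.val '' K :=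
    fun ω hω => hmem _ fun a => by
      rw [satSeq, abs_mul, abs_of_nonneg (fCoeff_nonneg T s p _ _)]
      exact mul_le_of_le_one_left (fCoeff_nonneg T s p _ _) (abs_le.2 (hω a))
  refine ⟨⟨K, hK, hin, hbd.mono hin⟩, ?_⟩
  filter_upwards [hbd, ae_hasLargeCoeffs hpos hξi hξu hcov] with ω hω hlarge
  exact maximallyDivergent_of_hasLargeCoeffs hd hψ hM hp hC₀ hlarge hω
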